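/- Let $S$ be a finite set and let $\Gamma$ be a finite simple graph with vertex set $S$, each of whose edges $st$ is labelled by an integer $m_{st}\ge 2$. Let $A_\Gamma$ be the Artin group and $A_\Gamma^+$ the Artin monoid of $\Gamma$, that is, the group and the monoid presented by the generators $S$ and the relations $sts\cdots = tst\cdots$ (alternating words of length $m_{st}$ on both sides), one for each edge $st$ of $\Gamma$. Elements of $A_\Gamma^+$ are regarded as elements of $A_\Gamma$ via the canonical homomorphism $A_\Gamma^+\to A_\Gamma$. Assume that $A_\Gamma$ is of finite type, i.e. that the Coxeter group $W_\Gamma$, obtained from $A_\Gamma$ by adding the relations $s^2=1$ ($s\in S$), is finite. For $a,b\in A_\Gamma^+$ write $a\preceq_L b$ if $b=ac$ for some $c\in A_\Gamma^+$, and $b\succeq_R a$ if $b=ca$ for some $c\in A_\Gamma^+$. Call $T\subseteq S$ spherical if the Coxeter group of the full subgraph of $\Gamma$ spanned by $T$ is finite; for such $T$ let $\Delta_T\in A_\Gamma^+$ be the Garside element, i.e. the element that is the least common multiple of $T$ both for $\preceq_L$ and for $\succeq_R$. Let $$\mathcal M=\{m\in A_\Gamma^+ : m\preceq_L\Delta_T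 \text{ for some spherical } T\subseteq S\}$$ be the set of minimal elements. Let $\mathcal G=\mathcal G(A_\Gamma,\mathcal M)$ be the Cayley graph with vertex set $A_\Gamma$ and an (undirected) edge between $g$ and $gm$ for all $g\in A_\Gamma$ and $m\in\mathcal M$, and let $\mathcal G^+$ be the full subgraph of $\mathcal G$ spanned by the elements of $A_\Gamma^+$. Equip the vertex set of each graph with its path metric. Proposition 6.1. The inclusion $\mathcal G^+\hookrightarrow\mathcal G$ is an isometric embedding: for all $a,b\in A_\Gamma^+$, the distance between $a$ and $b$ in $\mathcal G^+$ equals their distance in $\mathcal G$. Equivalently, for all $a,b\in A_\Gamma^+$ there is a geodesic of $\mathcal G$ from $a$ to $b$ all of whose vertices lie in $A_\Gamma^+$. -/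

import Mathlib

/-!
A finite simplicial graph with vertex set `S` and edges labelled by integers `m_{st} ≥ 2` is encoded
by Mathlib's `CoxeterMatrix S`: the entry `Γ s t` is the label of the edge `st`, the value `0` (no
relation) means that there is no edge (`m_{st} = ∞`), and the diagonal entries are `1`.
-/

namespace Artin

variable {S : Type*}

/-- The Coxeter matrix of the full subgraph of `Γ` spanned by `T`. -/
def restrict (Γ : CoxeterMatrix S) (T : Set S) : CoxeterMatrix T where
  M := Matrix.of fun s t => Γ s t
  isSymm := Matrix.IsSymm.ext fun s t => Γ.symmetric t s
  diagonal s := Γ.diagonal s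
  off_diagonal s t h := Γ.off_diagonal s t fun hst => h (Subtype.ext hst)

/-- `A_Γ` is of finite type if its Coxeter group `W_Γ` is finite. -/
def IsFiniteType (Γ : CoxeterMatrix S) : Prop :=
  Finite Γ.Group

/-- `T ⊆ S` is spherical if the special subgroup `A_T` is of finite type. -/
def IsSpherical (Γ : CoxeterMatrix S) (T : Set S) : Prop :=
  IsFiniteType (restrict Γ T)

/-- The braid relations as pairs of positive words: for every edge `st`, the two alternating words
of length `m_{st}` in the letters `s` and `t` are identified. -/
def monoidRels (Γ : CoxeterMatrix S) (u v : FreeMonoid S) : Prop :=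
  ∃ s t : S, Γ s t ≠ 0 ∧
    u = FreeMonoid.ofList (CoxeterSystem.braidWord Γ s t) ∧
    v = FreeMonoid.ofList (CoxeterSystem.braidWord Γ t s)

/-- The braid relations as elements `u * v⁻¹` of the free group. -/
def groupRels (Γ : CoxeterMatrix S) : Set (FreeGroup S) :=
  {r | ∃ u v : FreeMonoid S, monoidRels Γ u v ∧
    r = FreeMonoid.lift FreeGroup.of u * (FreeMonoid.lift FreeGroup.of v)⁻¹}

/-- The Artin group `A_Γ`. -/
abbrev ArtinGroup (Γ : CoxeterMatrix S) : Type _ :=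
  PresentedGroup (groupRels Γ)

/-- The Artin monoid `A_Γ⁺`. -/
abbrev ArtinMonoid (Γ : CoxeterMatrix S) : Type _ :=
  PresentedMonoid (monoidRels Γ)

/-- The standard generator of the Artin monoid attached to the vertex `s`. -/
def gen (Γ : CoxeterMatrix S) (s : S) : ArtinMonoid Γ :=
  PresentedMonoid.of (monoidRels Γ) s

theorem lift_eq_of_monoidRels (Γ : CoxeterMatrix S) (u v : FreeMonoid S) (h : monoidRels Γ u v) :
    FreeMonoid.lift (fun s => (PresentedGroup.of s : ArtinGroup Γ)) u =
      FreeMonoid.lift (fun s => (PresentedGroup.of s : ArtinGroup Γ)) v := by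
  have key : FreeMonoid.lift (fun s => (PresentedGroup.of s : ArtinGroup Γ)) =
      (PresentedGroup.mk (groupRels Γ)).comp (FreeMonoid.lift FreeGroup.of) :=
    FreeMonoid.hom_eq fun s => by simp [PresentedGroup.of]
  have hr : PresentedGroup.mk (groupRels Γ)
      (FreeMonoid.lift FreeGroup.of u * (FreeMonoid.lift FreeGroup.of v)⁻¹) = 1 :=
    PresentedGroup.one_of_mem ⟨u, v, h, rfl⟩
  rw [map_mul, map_inv, mul_inv_eq_one] at hr
  simpa [key] using hr

/-- The canonical homomorphism `A_Γ⁺ → A_Γ` that sends each standard generator to the standard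
generator of the same name. -/
def toGroup (Γ : CoxeterMatrix S) : ArtinMonoid Γ →* ArtinGroup Γ :=
  PresentedMonoid.lift (fun s => (PresentedGroup.of s : ArtinGroup Γ)) (lift_eq_of_monoidRels Γ)

/-- `d = lcm_L(X)`: `d` is a least common multiple of `X` for `≼_L`, where `a ≼_L b` is Mathlib's
`a ∣ b`: there is `c` in the monoid with `b = a * c`. -/
def IsLcmL {P : Type*} [Monoid P] (X : Set P) (d : P) : Prop :=
  (∀ x ∈ X, x ∣ d) ∧ ∀ b, (∀ x ∈ X, x ∣ b) → d ∣ b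

/-- `d = lcm_R(X)`: `d` is a least common multiple of `X` for `≽_R`, where `b ≽_R a` is Mathlib's
`RightDvd a b`: there is `c` in the monoid with `b = c * a`. -/
def IsLcmR {P : Type*} [Monoid P] (X : Set P) (d : P) : Prop :=
  (∀ x ∈ X, RightDvd x d) ∧ ∀ b, (∀ x ∈ X, RightDvd x b) → RightDvd d b

/-- `d` is the Garside element `Δ_T = lcm_L(T) = lcm_R(T)`. -/
def IsGarsideElement (Γ : CoxeterMatrix S) (T : Set S) (d : ArtinMonoid Γ) : Prop :=
  IsLcmL (gen Γ '' T) d ∧ IsLcmR (gen Γ '' T) d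

/-- The set `ℳ` of minimal elements: all `m` in the Artin monoid with `m ≼_L Δ_T` for some
spherical `T ⊆ S`. -/
def minimalElements (Γ : CoxeterMatrix S) : Set (ArtinMonoid Γ) :=
  {m | ∃ (T : Set S) (d : ArtinMonoid Γ),
    IsSpherical Γ T ∧ IsGarsideElement Γ T d ∧ m ∣ d}

/-- The Cayley graph `𝒢(A_Γ, ℳ)`: its vertices are the elements of `A_Γ`, and its edges join `g` to
`g * m` for `m ∈ ℳ` (loops, which come from `m = 1`, and multiplicities are dropped; they play no
role for path lengths). -/
def cayleyGraph (Γ : CoxeterMatrix S) : SimpleGraph (ArtinGroup Γ) :=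
  SimpleGraph.mulCayley (toGroup Γ '' minimalElements Γ)

/-- The elements of the Artin group that lie in the Artin monoid. -/
def positiveElements (Γ : CoxeterMatrix S) : Set (ArtinGroup Γ) :=
  Set.range (toGroup Γ)

/-- The monoid Cayley graph `𝒢⁺(A_Γ, ℳ)`: the full subgraph of `𝒢(A_Γ, ℳ)` spanned by the elements
of the Artin monoid. -/
def monoidCayleyGraph (Γ : CoxeterMatrix S) : SimpleGraph (positiveElements Γ) :=
  (cayleyGraph Γ).induce (positiveElements Γ)

end Artin

/-!
Let `W` be the finite Coxeter group, `w₀` its longest element, and `Δ` the positive lift of `w₀`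
to the Artin monoid. The minimal elements are the divisors of `Δ` (`mem_minimalElements_iff`).
Order the Artin group by `x ≤ y` if `x⁻¹ * y` lies in the monoid. Two vertices of the Cayley graph
are equal or adjacent exactly if `x ≤ y ≤ x * Δ`, up to exchanging `x` and `y`. Every `x` has a
join `x ∨ 1`, and `x ↦ x ∨ 1` maps the group to the monoid and fixes the monoid. If
`x ≤ y ≤ x * Δ`, then `x ∨ 1 ≤ y ∨ 1`; moreover `y ≤ x * Δ ≤ (x ∨ 1) * Δ`, because conjugation by
`Δ` preserves the monoid, hence `y ∨ 1 ≤ (x ∨ 1) * Δ` (`exists_joinOne_mul_eq`). So the Cayley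
graph retracts onto the monoid Cayley graph without increasing distances
(`edist_monoidCayleyGraph`).

The join exists because the monoid embeds into the group (`toGroup_injective`) and has least
common multiples (`exists_lcm_artin`). Both rest on the weak order of `W`. The positive lift
`posLift` of `W` to the monoid is well defined by Matsumoto's theorem (`wordGen_eq_of_isReduced`).
As `W` is a lattice for the weak order, for `u, w : W` there is a largest `v ≤ w` such that
`u * v` is a reduced product (`maxReduced`). The rule `maxReduced_mul` shows that the monoid acts
on pairs `(w, y)`, which stand for the products `posLift w * y`, by multiplying on the left and
collecting as much as possible in the first entry. Acting on `(1, 1)` one obtains for every `x` a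
greatest divisor `head x` in `W`, with quotient `tail x`; since `x` is recovered from them and
they are computed step by step, left cancellation follows (`eq_of_posLift_mul`), and divisibility
by elements of `W` can be tested in the weak order (`posLift_dvd_iff`). Common multiples exist
because `Δ` normalizes the monoid, and the embedding into the group is then Ore's theorem.

Two facts about Coxeter groups are proved on the way: the order of `s_i s_j` is exactly `m_{ij}`,
from the reflection representation, and the strong exchange condition (`isLeftInversion_mul_iff`),
from an action of `W` by signed conjugation on `W × ZMod 2`.
-/

/-! ### The reflection representation and the order of a product of two generators -/

namespace CoxeterMatrix

open Polynomial

variable {B : Type*} (M : CoxeterMatrix B)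

/-- Twice the cosine of `π / m_{ij}`. Division by zero gives the value `2` for the entry `0`, which
is the right one, as `0` encodes `m_{ij} = ∞`. -/
noncomputable def cosCoeff (i j : B) : ℂ :=
  2 * Complex.cos (Real.pi / M i j)

theorem cosCoeff_self (i : B) : M.cosCoeff i i = -2 := by
  simp [cosCoeff]

theorem cosCoeff_comm (i j : B) : M.cosCoeff i j = M.cosCoeff j i := by
  simp [cosCoeff, M.symmetric i j]

/-- The simple reflection `f ↦ f + f(i) κ_i` with `κ_i(j) = 2 cos (π / m_{ij})`, which is the
contragredient of the geometric representation in the basis dual to the simple roots. -/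
noncomputable def dualReflection (i : B) : Module.End ℂ (B → ℂ) where
  toFun f j := f j + M.cosCoeff i j * f i
  map_add' f g := by ext j; simp; ring
  map_smul' c f := by ext j; simp; ring

theorem dualReflection_apply (i : B) (f : B → ℂ) (j : B) :
    M.dualReflection i f j = f j + M.cosCoeff i j * f i := rfl

theorem dualReflection_mul_self (i : B) : M.dualReflection i * M.dualReflection i = 1 := by
  refine LinearMap.ext fun f => funext fun j => ?_
  simp only [Module.End.mul_apply, dualReflection_apply, cosCoeff_self, Module.End.one_apply]
  ring

theorem dualReflection_mul_apply (i j : B) (f : B → ℂ) (k : B) :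
    (M.dualReflection i * M.dualReflection j) f k =
      f k + M.cosCoeff j k * f j + M.cosCoeff i k * (f i + M.cosCoeff i j * f j) := by
  simp only [Module.End.mul_apply, dualReflection_apply, M.cosCoeff_comm j i]

/-- The half-angle root of unity `exp (π I / m)`. -/
noncomputable def halfRoot (i j : B) : ℂ := Complex.exp (Real.pi * Complex.I / M i j)

theorem halfRoot_ne_zero (i j : B) : M.halfRoot i j ≠ 0 := Complex.exp_ne_zero _

theorem cosCoeff_eq (i j : B) : M.cosCoeff i j = M.halfRoot i j + (M.halfRoot i j)⁻¹ := by
  rw [cosCoeff, halfRoot, Complex.cos, ← Complex.exp_neg]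
  ring_nf

theorem isPrimitiveRoot_halfRoot_sq (i j : B) (h : M i j ≠ 0) :
    IsPrimitiveRoot (M.halfRoot i j ^ 2) (M i j) := by
  have := Complex.isPrimitiveRoot_exp (M i j) h
  rwa [halfRoot, ← Complex.exp_nat_mul, show ((2 : ℕ) : ℂ) * (Real.pi * Complex.I / M i j) =
    2 * Real.pi * Complex.I / M i j by push_cast; ring]

/-- The product of two simple reflections is annihilated by `(X - 1)(X - ζ)(X - ζ⁻¹)`, where
`ζ = exp (2 π I / m)`. -/
theorem dualReflection_mul_aeval (i j : B) :
    aeval (M.dualReflection i * M.dualReflection j)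
      ((X - C 1) * ((X - C (M.halfRoot i j ^ 2)) * (X - C ((M.halfRoot i j ^ 2)⁻¹)))) = 0 := by
  have hz := M.halfRoot_ne_zero i j
  refine LinearMap.ext fun f => funext fun k => ?_
  simp only [map_mul, map_sub, aeval_X, aeval_C, Module.End.mul_apply, LinearMap.sub_apply,
    Pi.sub_apply, Module.algebraMap_end_apply, Pi.smul_apply, dualReflection_apply, cosCoeff_self,
    M.cosCoeff_comm j i, smul_eq_mul, LinearMap.zero_apply, Pi.zero_apply]
  rw [M.cosCoeff_eq i j]
  field_simp
  ring

theorem dualReflection_mul_pow (i j : B) :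
    (M.dualReflection i * M.dualReflection j) ^ M i j = 1 := by
  rcases eq_or_ne i j with rfl | hij
  · simp [dualReflection_mul_self]
  rcases eq_or_ne (M i j) 0 with h0 | h0
  · simp [h0]
  rcases eq_or_ne (M i j) 2 with h2 | h2
  · have hc : M.cosCoeff i j = 0 := by simp [cosCoeff, h2]
    rw [h2, pow_two]
    refine LinearMap.ext fun f => funext fun k => ?_
    rw [Module.End.mul_apply]
    simp only [dualReflection_mul_apply, hc, M.cosCoeff_comm j i, cosCoeff_self,
      Module.End.one_apply]
    ring
  have h1 := M.off_diagonal i j hij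
  have hprim := M.isPrimitiveRoot_halfRoot_sq i j h0
  set ζ := M.halfRoot i j ^ 2
  have hζ1 : ζ ≠ 1 := hprim.ne_one (by omega)
  have hζ2 : ζ ^ 2 ≠ 1 := hprim.pow_ne_one_of_pos_of_lt (by omega) (by omega)
  have hζ0 : ζ ≠ 0 := hprim.ne_zero h0
  -- the annihilating polynomial has three distinct roots, all of them `m`-th roots of unity
  have hdvd : ((X - C 1) * ((X - C ζ) * (X - C ζ⁻¹)) : ℂ[X]) ∣ X ^ M i j - 1 := by
    rw [X_pow_sub_one_eq_prod (Nat.pos_of_ne_zero h0) hprim]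
    have hsub : ({1, ζ, ζ⁻¹} : Finset ℂ) ⊆ nthRootsFinset (M i j) (1 : ℂ) := by
      intro x hx
      rw [mem_nthRootsFinset (Nat.pos_of_ne_zero h0)]
      simp only [Finset.mem_insert, Finset.mem_singleton] at hx
      rcases hx with rfl | rfl | rfl <;> simp [hprim.pow_eq_one]
    refine dvd_trans (dvd_of_eq ?_) (Finset.prod_dvd_prod_of_subset _ _ _ hsub)
    rw [Finset.prod_insert, Finset.prod_insert, Finset.prod_singleton]
    · simp only [Finset.mem_singleton]
      intro h
      exact hζ2 (by rw [pow_two]; nth_rewrite 1 [h]; exact inv_mul_cancel₀ hζ0)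
    · simp only [Finset.mem_insert, Finset.mem_singleton, not_or]
      exact ⟨hζ1.symm, fun h => hζ1 (by rw [← inv_inv ζ, ← h, inv_one])⟩
  obtain ⟨q, hq⟩ := hdvd
  have := congrArg (aeval (M.dualReflection i * M.dualReflection j)) hq
  rw [map_mul, M.dualReflection_mul_aeval, zero_mul] at this
  simpa [sub_eq_zero] using this

theorem dvd_of_dualReflection_mul_pow_eq_one {i j : B} (hij : i ≠ j) {k : ℕ}
    (h : (M.dualReflection i * M.dualReflection j) ^ k = 1) : M i j ∣ k := by
  classical
  set T := M.dualReflection i * M.dualReflection j with hT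
  rcases eq_or_ne (M i j) 0 with h0 | h0
  · -- here `T` is unipotent on the coordinates `i` and `j`
    have hc : M.cosCoeff i j = 2 := by simp [cosCoeff, h0]
    have key : ∀ (n : ℕ) (f : B → ℂ), (T ^ n) f i = f i - 2 * n * (f i + f j) := by
      intro n
      induction n with
      | zero => simp
      | succ n ih =>
        intro f
        rw [pow_succ, Module.End.mul_apply, ih]
        simp only [hT, dualReflection_mul_apply, hc, M.cosCoeff_comm j i, cosCoeff_self]
        push_cast
        ring
    have := key k (Pi.single i 1)
    rw [h] at this
    simp [hij.symm] at this
    have hk : (k : ℂ) = 0 := by linear_combination (1 / 2) * this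
    rw [h0, Nat.cast_eq_zero.mp hk]
  · -- `f ↦ f i + z * f j` is an eigenvector of the transpose of `T`, with eigenvalue `z ^ 2`
    have hz := M.halfRoot_ne_zero i j
    have hprim := M.isPrimitiveRoot_halfRoot_sq i j h0
    have hc := M.cosCoeff_eq i j
    set z := M.halfRoot i j
    have key : ∀ (n : ℕ) (f : B → ℂ),
        (T ^ n) f i + z * (T ^ n) f j = (z ^ 2) ^ n * (f i + z * f j) := by
      intro n
      induction n with
      | zero => simp
      | succ n ih =>
        intro f
        rw [pow_succ, Module.End.mul_apply, ih]
        simp only [hT, dualReflection_mul_apply, hc, M.cosCoeff_comm j i, cosCoeff_self]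
        field_simp
        ring
    have := key k (Pi.single i 1)
    rw [h] at this
    simp [hij.symm] at this
    exact hprim.dvd_of_pow_eq_one k this.symm

end CoxeterMatrix

namespace CoxeterSystem

variable {B W : Type*} [Group W] {M : CoxeterMatrix B} (cs : CoxeterSystem M W)

/-- The order of `s_i s_j` is not smaller than its presentation suggests. -/
theorem dvd_of_simple_mul_simple_pow_eq_one {i j : B} (hij : i ≠ j) {k : ℕ}
    (h : (cs.simple i * cs.simple j) ^ k = 1) : M i j ∣ k := by
  have hl : M.IsLiftable M.dualReflection := M.dualReflection_mul_pow
  refine M.dvd_of_dualReflection_mul_pow_eq_one hij ?_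
  have := congrArg (cs.lift ⟨_, hl⟩) h
  simpa [cs.lift_apply_simple hl] using this

end CoxeterSystem

/-! ### The strong exchange condition -/

theorem Function.End.mul_apply' {α : Type*} (f g : Function.End α) (x : α) :
    (f * g) x = f (g x) := rfl

namespace CoxeterSystem

variable {B W : Type*} [Group W] {M : CoxeterMatrix B} (cs : CoxeterSystem M W)

open Classical in
/-- The action of a simple generator on `W × ZMod 2` that keeps track of the parity of the number of
times a given element occurs among the inversions of a word. -/
noncomputable def signedConj (i : B) : Function.End (W × ZMod 2) := fun p =>
  (cs.simple i * p.1 * cs.simple i, p.2 + if p.1 = cs.simple i then 1 else 0)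

open Classical in
theorem signedConj_mul_pow_apply (i j : B) (n : ℕ) (p : W × ZMod 2) :
    ((cs.signedConj i * cs.signedConj j) ^ n) p =
      ((cs.simple i * cs.simple j) ^ n * p.1 * ((cs.simple i * cs.simple j) ^ n)⁻¹,
        p.2 + ∑ l ∈ Finset.range (2 * n),
          if p.1 = (cs.simple j * cs.simple i) ^ l * cs.simple j then 1 else 0) := by
  induction n generalizing p with
  | zero => simp [Function.End.one_def]
  | succ n ih =>
    have hstep : (cs.signedConj i * cs.signedConj j) p =
        ((cs.simple i * cs.simple j) * p.1 * (cs.simple i * cs.simple j)⁻¹,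
          p.2 + (if p.1 = cs.simple j then 1 else 0) +
            if p.1 = (cs.simple j * cs.simple i) * cs.simple j then 1 else 0) := by
      have h : cs.simple j * p.1 * cs.simple j = cs.simple i ↔
          p.1 = (cs.simple j * cs.simple i) * cs.simple j := by
        constructor <;> intro h
        · rw [← h]; simp [mul_assoc]
        · rw [h]; simp [mul_assoc]
      simp only [Function.End.mul_apply', signedConj, h, mul_inv_rev, inv_simple]
      simp only [mul_assoc]
    rw [pow_succ, Function.End.mul_apply', hstep, ih]
    refine Prod.ext ?_ ?_
    · simp only [pow_succ, mul_inv_rev, mul_assoc]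
    · have h : ∀ l, (cs.simple i * cs.simple j) * p.1 * (cs.simple i * cs.simple j)⁻¹ =
          (cs.simple j * cs.simple i) ^ l * cs.simple j ↔
          p.1 = (cs.simple j * cs.simple i) ^ (l + 2) * cs.simple j := by
        intro l
        rw [mul_inv_eq_iff_eq_mul, ← eq_inv_mul_iff_mul_eq]
        have : (cs.simple i * cs.simple j)⁻¹ *
            ((cs.simple j * cs.simple i) ^ l * cs.simple j * (cs.simple i * cs.simple j)) =
            (cs.simple j * cs.simple i) ^ (l + 2) * cs.simple j := by
          rw [pow_succ, pow_succ']
          simp only [mul_inv_rev, inv_simple, mul_assoc]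
        rw [this]
      simp only [h]
      rw [show 2 * (n + 1) = 2 * n + 1 + 1 by ring, Finset.sum_range_succ', Finset.sum_range_succ']
      simp only [pow_zero, zero_add, pow_one, one_mul]
      ring

theorem signedConj_mul_pow (i j : B) : (cs.signedConj i * cs.signedConj j) ^ M i j = 1 := by
  classical
  funext p
  rw [signedConj_mul_pow_apply, simple_mul_simple_pow, two_mul, Finset.sum_range_add]
  simp only [pow_add, simple_mul_simple_pow', one_mul, CharTwo.add_self_eq_zero, inv_one, mul_one,
    add_zero]
  rfl

/-- The action of `W` on `W × ZMod 2` in which simple generators act by `signedConj`. -/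
noncomputable def signedConjHom : W →* Function.End (W × ZMod 2) :=
  cs.lift ⟨_, cs.signedConj_mul_pow⟩

theorem signedConjHom_simple (i : B) : cs.signedConjHom (cs.simple i) = cs.signedConj i :=
  cs.lift_apply_simple cs.signedConj_mul_pow i

/-- The parity of the number of occurrences of `t` in the right inversion sequence of a word for
`w`; it depends on `w` only. -/
noncomputable def invParity (w t : W) : ZMod 2 := (cs.signedConjHom w (t, 0)).2

open Classical in
theorem signedConjHom_wordProd (ω : List B) (p : W × ZMod 2) :
    cs.signedConjHom (cs.wordProd ω) p =
      (cs.wordProd ω * p.1 * (cs.wordProd ω)⁻¹, p.2 + (cs.rightInvSeq ω).count p.1) := by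
  induction ω with
  | nil => simp [Function.End.one_def]
  | cons i ω ih =>
    rw [wordProd_cons, map_mul, Function.End.mul_apply', ih,
      signedConjHom_simple, signedConj, rightInvSeq, List.count_cons]
    have h : cs.wordProd ω * p.1 * (cs.wordProd ω)⁻¹ = cs.simple i ↔
        (cs.wordProd ω)⁻¹ * cs.simple i * cs.wordProd ω = p.1 := by
      constructor <;> intro h
      · rw [← h]; group
      · rw [← h]; group
    refine Prod.ext ?_ ?_
    · simp [mul_assoc]
    · simp only [h, beq_iff_eq]
      push_cast
      ring

theorem signedConjHom_apply (w : W) (p : W × ZMod 2) :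
    cs.signedConjHom w p = (w * p.1 * w⁻¹, p.2 + cs.invParity w p.1) := by
  obtain ⟨ω, rfl⟩ := cs.wordProd_surjective w
  simp [invParity, signedConjHom_wordProd]

theorem invParity_mul (u v t : W) :
    cs.invParity (u * v) t = cs.invParity v t + cs.invParity u (v * t * v⁻¹) := by
  have : cs.signedConjHom (u * v) (t, 0) = cs.signedConjHom u (cs.signedConjHom v (t, 0)) := by
    rw [map_mul]; rfl
  simpa [signedConjHom_apply] using congrArg Prod.snd this

theorem invParity_self {t : W} (ht : cs.IsReflection t) : cs.invParity t t = 1 := by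
  obtain ⟨u, i, rfl⟩ := ht
  have h1 : cs.invParity 1 (u * cs.simple i * u⁻¹) = 0 := by
    simp [invParity, Function.End.one_def]
  have h2 := cs.invParity_mul u u⁻¹ (u * cs.simple i * u⁻¹)
  have h3 : u⁻¹ * (u * cs.simple i * u⁻¹) * u⁻¹⁻¹ = cs.simple i := by group
  rw [mul_inv_cancel, h1, h3] at h2
  have h4 : cs.invParity (cs.simple i) (cs.simple i) = 1 := by
    simp [invParity, signedConjHom_simple, signedConj]
  rw [mul_assoc, invParity_mul, invParity_mul]
  rw [mul_assoc u, ← mul_assoc] at h3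
  simp only [mul_inv_rev, mul_assoc, inv_mul_cancel_left, inv_inv, mul_one,
    inv_simple, simple_mul_simple_cancel_left, inv_mul_cancel, h4] at h2 ⊢
  linear_combination -h2

theorem isRightInversion_iff_invParity {w t : W} (ht : cs.IsReflection t) :
    cs.IsRightInversion w t ↔ cs.invParity w t = 1 := by
  classical
  have key : ∀ v, cs.invParity v t = 1 → cs.IsRightInversion v t := by
    intro v hv
    obtain ⟨ω, hω, rfl⟩ := cs.exists_isReduced v
    refine cs.isRightInversion_of_mem_rightInvSeq hω ?_
    by_contra hmem
    simp [invParity, signedConjHom_wordProd, List.count_eq_zero_of_not_mem hmem] at hv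
  refine ⟨fun h => ?_, key w⟩
  by_contra hne
  have h0 : cs.invParity w t = 0 := by
    generalize cs.invParity w t = a at hne
    revert hne; revert a; decide
  have h1 : cs.invParity (w * t) t = 1 := by
    rw [invParity_mul, cs.invParity_self ht]
    simp [h0]
  exact (ht.isRightInversion_mul_left_iff.mp (key _ h1)) h

/-- The strong exchange condition, in the form of the cocycle rule for the set of inversions. -/
theorem isLeftInversion_mul_iff {t : W} (ht : cs.IsReflection t) (u v : W) :
    cs.IsLeftInversion (u * v) t ↔
      Xor (cs.IsLeftInversion u t) (cs.IsLeftInversion v (u⁻¹ * t * u)) := by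
  have ht' : cs.IsReflection (u⁻¹ * t * u) := by simpa using ht.conj u⁻¹
  rw [← isRightInversion_inv_iff, ← isRightInversion_inv_iff, ← isRightInversion_inv_iff,
    cs.isRightInversion_iff_invParity ht, cs.isRightInversion_iff_invParity ht,
    cs.isRightInversion_iff_invParity ht', mul_inv_rev, invParity_mul, inv_inv]
  generalize cs.invParity u⁻¹ t = a
  generalize cs.invParity v⁻¹ (u⁻¹ * t * u) = b
  revert a b
  decide

/-! ### Reduced products -/

/-- The product `u * v` is reduced: the lengths add up. -/
def IsReducedMul (u v : W) : Prop := cs.length (u * v) = cs.length u + cs.length v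

/-- The weak order, by prefixes: `w` is a reduced product `u * c`. -/
def WeakLE (u w : W) : Prop := ∃ c, cs.IsReducedMul u c ∧ w = u * c

variable {cs}

theorem isReducedMul_one_right (u : W) : cs.IsReducedMul u 1 := by simp [IsReducedMul]

theorem isReducedMul_one_left (u : W) : cs.IsReducedMul 1 u := by simp [IsReducedMul]

theorem isReducedMul_assoc {u v w : W} :
    cs.IsReducedMul u v ∧ cs.IsReducedMul (u * v) w ↔
      cs.IsReducedMul v w ∧ cs.IsReducedMul u (v * w) := by
  have h1 := cs.length_mul_le u v
  have h2 := cs.length_mul_le v w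
  have h3 := cs.length_mul_le (u * v) w
  have h4 := cs.length_mul_le u (v * w)
  simp only [IsReducedMul, mul_assoc] at *
  omega

theorem isReducedMul_inv {u v : W} : cs.IsReducedMul v⁻¹ u⁻¹ ↔ cs.IsReducedMul u v := by
  rw [IsReducedMul, ← mul_inv_rev, length_inv, length_inv, length_inv, add_comm, IsReducedMul]

theorem isReducedMul_simple_left {i : B} {w : W} :
    cs.IsReducedMul (cs.simple i) w ↔ ¬ cs.IsLeftInversion w (cs.simple i) := by
  rw [isLeftInversion_simple_iff_isLeftDescent, not_isLeftDescent_iff, IsReducedMul, length_simple,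
    add_comm]

theorem weakLE_refl (u : W) : cs.WeakLE u u := ⟨1, isReducedMul_one_right u, (mul_one u).symm⟩

theorem one_weakLE (u : W) : cs.WeakLE 1 u := ⟨u, isReducedMul_one_left u, (one_mul u).symm⟩

theorem WeakLE.trans {u v w : W} (h : cs.WeakLE u v) (h' : cs.WeakLE v w) : cs.WeakLE u w := by
  obtain ⟨c, hc, rfl⟩ := h
  obtain ⟨d, hd, rfl⟩ := h'
  exact ⟨c * d, (isReducedMul_assoc.mp ⟨hc, hd⟩).2, mul_assoc _ _ _⟩

theorem WeakLE.length_le {u w : W} (h : cs.WeakLE u w) : cs.length u ≤ cs.length w := by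
  obtain ⟨c, hc, rfl⟩ := h
  rw [hc]; omega

theorem WeakLE.eq_of_length_le {u w : W} (h : cs.WeakLE u w) (hl : cs.length w ≤ cs.length u) :
    u = w := by
  obtain ⟨c, hc, rfl⟩ := h
  rw [hc] at hl
  rw [cs.length_eq_zero_iff.mp (by omega : cs.length c = 0), mul_one]

theorem WeakLE.antisymm {u w : W} (h : cs.WeakLE u w) (h' : cs.WeakLE w u) : u = w :=
  h.eq_of_length_le h'.length_le

theorem WeakLE.isReducedMul {u w : W} (h : cs.WeakLE u w) : cs.IsReducedMul u (u⁻¹ * w) := by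
  obtain ⟨c, hc, rfl⟩ := h
  rwa [inv_mul_cancel_left]

theorem WeakLE.mul_left {u v w : W} (h : cs.WeakLE v w) (hr : cs.IsReducedMul u w) :
    cs.WeakLE (u * v) (u * w) ∧ cs.IsReducedMul u v := by
  obtain ⟨c, hc, rfl⟩ := h
  obtain ⟨h1, h2⟩ := isReducedMul_assoc.mpr ⟨hc, hr⟩
  exact ⟨⟨c, h2, (mul_assoc _ _ _).symm⟩, h1⟩

theorem weakLE_of_mul_left {u v w : W} (hv : cs.IsReducedMul u v) (h : cs.WeakLE (u * v) (u * w)) :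
    cs.WeakLE v w := by
  obtain ⟨c, hc, h⟩ := h
  rw [mul_assoc, mul_right_inj] at h
  exact ⟨c, (isReducedMul_assoc.mp ⟨hv, hc⟩).1, h⟩

theorem simple_weakLE_iff {i : B} {w : W} :
    cs.WeakLE (cs.simple i) w ↔ cs.IsLeftInversion w (cs.simple i) := by
  rw [isLeftInversion_simple_iff_isLeftDescent, isLeftDescent_iff]
  constructor
  · rintro ⟨c, hc, rfl⟩
    rw [hc, simple_mul_simple_cancel_left, length_simple, add_comm]
  · intro h
    exact ⟨cs.simple i * w, by simp [IsReducedMul]; omega, by simp⟩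

theorem exists_simple_weakLE {w : W} (hw : w ≠ 1) : ∃ i, cs.WeakLE (cs.simple i) w := by
  obtain ⟨i, hi⟩ := cs.exists_leftDescent_of_ne_one hw
  exact ⟨i, simple_weakLE_iff.mpr ((cs.isLeftInversion_simple_iff_isLeftDescent w i).mpr hi)⟩

theorem isReduced_append {ω ω' : List B} (h : cs.IsReduced ω) (h' : cs.IsReduced ω')
    (hr : cs.IsReducedMul (cs.wordProd ω) (cs.wordProd ω')) : cs.IsReduced (ω ++ ω') := by
  rw [IsReduced, wordProd_append, hr, h.eq, h'.eq, List.length_append]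

theorem isReduced_cons_iff {i : B} {ω : List B} :
    cs.IsReduced (i :: ω) ↔
      cs.IsReduced ω ∧ cs.IsReducedMul (cs.simple i) (cs.wordProd ω) := by
  have h1 := cs.length_wordProd_le ω
  have h2 := cs.length_mul_le (cs.simple i) (cs.wordProd ω)
  simp only [IsReduced, IsReducedMul, wordProd_cons, List.length_cons, length_simple] at *
  omega

/-! ### Dihedral subgroups and the longest element -/

/-- The alternating word `i j i ⋯` of length `n` that starts with `i`. -/
def altWord (i j : B) : ℕ → List B
  | 0 => []
  | n + 1 => i :: altWord j i n

theorem alternatingWord_eq_altWord (i j : B) (n : ℕ) :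
    alternatingWord i j n = if Even n then altWord i j n else altWord j i n := by
  induction n with
  | zero => simp [altWord, alternatingWord]
  | succ n ih =>
    rw [alternatingWord_succ', ih]
    by_cases h : Even n <;> simp [h, altWord, Nat.even_add_one]

variable (cs) in
theorem wordProd_altWord_comm (i j : B) :
    cs.wordProd (altWord i j (M i j)) = cs.wordProd (altWord j i (M i j)) := by
  have h := cs.wordProd_braidWord_eq i j
  rw [braidWord, braidWord, M.symmetric j i, alternatingWord_eq_altWord,
    alternatingWord_eq_altWord] at h
  split_ifs at h
  exacts [h, h.symm]

/-- The inversions of the alternating word `i j i ⋯` are the reflections `(s_i s_j) ^ l s_i`. -/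
theorem exists_eq_pow_of_isLeftInversion_altWord {i j : B} {n : ℕ} {t : W}
    (h : cs.IsLeftInversion (cs.wordProd (altWord i j n)) t) :
    ∃ l < n, t = (cs.simple i * cs.simple j) ^ l * cs.simple i := by
  induction n generalizing i j t with
  | zero => simp [altWord, IsLeftInversion] at h
  | succ n ih =>
    rw [altWord, wordProd_cons, cs.isLeftInversion_mul_iff h.1] at h
    rcases h.or with h | h
    · refine ⟨0, n.succ_pos, ?_⟩
      have h2 := h.2
      rw [length_simple, Nat.lt_one_iff, length_eq_zero_iff, mul_eq_one_iff_eq_inv] at h2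
      simpa using h2
    · obtain ⟨l, hl, ht⟩ := ih h
      refine ⟨l + 1, by omega, ?_⟩
      have ht' : t = cs.simple i * ((cs.simple j * cs.simple i) ^ l * cs.simple j) *
          cs.simple i := by
        rw [← ht]; simp [mul_assoc]
      rw [ht', ← mul_assoc, mul_pow_mul]
      simp only [pow_succ, mul_assoc]

/-- A word alternating between `i` and `j` which is shorter than `m_{ij}` can be prolonged to the
left. -/
theorem not_isLeftInversion_altWord {i j : B} (hij : i ≠ j) {n : ℕ}
    (hn : M i j = 0 ∨ n < M i j) :
    ¬ cs.IsLeftInversion (cs.wordProd (altWord i j n)) (cs.simple j) := by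
  intro h
  obtain ⟨l, hl, ht⟩ := exists_eq_pow_of_isLeftInversion_altWord h
  have h1 : (cs.simple i * cs.simple j) ^ (l + 1) = 1 := by
    rw [pow_succ, ← mul_assoc, ← ht, simple_mul_simple_self]
  have h2 := cs.dvd_of_simple_mul_simple_pow_eq_one hij h1
  rcases hn with hn | hn
  · rw [hn, zero_dvd_iff] at h2
    omega
  · have := Nat.le_of_dvd l.succ_pos h2
    omega

theorem wordProd_altWord_mem {H : Subgroup W} {i j : B} (hi : cs.simple i ∈ H)
    (hj : cs.simple j ∈ H) (n : ℕ) : cs.wordProd (altWord i j n) ∈ H := by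
  induction n generalizing i j with
  | zero => simp [altWord, H.one_mem]
  | succ n ih =>
    rw [altWord, wordProd_cons]
    exact H.mul_mem hi (ih hj hi)

theorem exists_altWord_of_simple_mul {i j : B} {u : W}
    (hu : ∃ n, (M i j = 0 ∨ n ≤ M i j) ∧
      (u = cs.wordProd (altWord i j n) ∨ u = cs.wordProd (altWord j i n))) :
    ∃ n, (M i j = 0 ∨ n ≤ M i j) ∧
      (cs.simple i * u = cs.wordProd (altWord i j n) ∨
        cs.simple i * u = cs.wordProd (altWord j i n)) := by
  obtain ⟨n, hn, hu⟩ := hu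
  have aux : ∀ n, (M i j = 0 ∨ n ≤ M i j) → u = cs.wordProd (altWord i j n) → n ≠ 0 →
      ∃ n, (M i j = 0 ∨ n ≤ M i j) ∧
      (cs.simple i * u = cs.wordProd (altWord i j n) ∨
        cs.simple i * u = cs.wordProd (altWord j i n)) := by
    intro n hn hu h0
    obtain ⟨n, rfl⟩ := Nat.exists_eq_succ_of_ne_zero h0
    refine ⟨n, by omega, Or.inr ?_⟩
    rw [hu, altWord, wordProd_cons, simple_mul_simple_cancel_left]
  by_cases hlt : M i j = 0 ∨ n < M i j
  · rcases hu with hu | hu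
    · rcases Nat.eq_zero_or_pos n with rfl | h0
      · exact ⟨1, by omega, Or.inl (by simp [hu, altWord])⟩
      · exact aux n hn hu h0.ne'
    · exact ⟨n + 1, by omega, Or.inl (by rw [hu, altWord, wordProd_cons])⟩
  · have hn' : n = M i j := by omega
    subst hn'
    refine aux _ hn ?_ (by omega)
    rcases hu with hu | hu
    · exact hu
    · rw [hu, wordProd_altWord_comm]

/-- The elements of a dihedral subgroup are spelled by alternating words of length at most
`m_{ij}`. -/
theorem exists_altWord_of_mem_closure {i j : B} {u : W}
    (hu : u ∈ Subgroup.closure {cs.simple i, cs.simple j}) :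
    ∃ n, (M i j = 0 ∨ n ≤ M i j) ∧
      (u = cs.wordProd (altWord i j n) ∨ u = cs.wordProd (altWord j i n)) := by
  have hj : ∀ u : W, (∃ n, (M i j = 0 ∨ n ≤ M i j) ∧
      (u = cs.wordProd (altWord i j n) ∨ u = cs.wordProd (altWord j i n))) →
      ∃ n, (M i j = 0 ∨ n ≤ M i j) ∧ (cs.simple j * u = cs.wordProd (altWord i j n) ∨
        cs.simple j * u = cs.wordProd (altWord j i n)) := by
    intro u hu
    have := exists_altWord_of_simple_mul (cs := cs) (i := j) (j := i) (u := u)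
    simp only [M.symmetric j i] at this
    simpa only [or_comm (a := _ = cs.wordProd (altWord j i _))] using this
      (by simpa only [or_comm (a := _ = cs.wordProd (altWord j i _))] using hu)
  induction hu using Subgroup.closure_induction_left with
  | one => exact ⟨0, by omega, Or.inl (by simp [altWord])⟩
  | mul_left x hx y hy ih =>
    rcases hx with rfl | rfl
    · exact exists_altWord_of_simple_mul ih
    · exact hj y ih
  | inv_mul_cancel x hx y hy ih =>
    rcases hx with rfl | rfl
    · rw [inv_simple]
      exact exists_altWord_of_simple_mul ih
    · rw [inv_simple]
      exact hj y ih

/-- If `i` and `j` are distinct left descents of `w`, then `m_{ij}` is finite and the braid word on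
`i` and `j` is a reduced prefix of `w`. The proof splits off from `w` the shortest element `v` of
its coset for the dihedral subgroup; the other factor must then be the longest dihedral element. -/
theorem altWord_weakLE {i j : B} (hij : i ≠ j) {w : W} (hi : cs.WeakLE (cs.simple i) w)
    (hj : cs.WeakLE (cs.simple j) w) :
    M i j ≠ 0 ∧ cs.IsReduced (altWord i j (M i j)) ∧
      cs.WeakLE (cs.wordProd (altWord i j (M i j))) w := by
  classical
  rw [simple_weakLE_iff] at hi hj
  set H := Subgroup.closure {cs.simple i, cs.simple j} with hH
  have hiH : cs.simple i ∈ H := Subgroup.subset_closure (by simp)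
  have hjH : cs.simple j ∈ H := Subgroup.subset_closure (by simp)
  obtain ⟨v, ⟨u, hu, hw⟩, hmin⟩ := exists_minimalFor_of_wellFoundedLT
    (fun v : W => ∃ u ∈ H, w = u * v) cs.length ⟨w, 1, H.one_mem, (one_mul w).symm⟩
  have hv : ∀ t ∈ H, ¬ cs.IsLeftInversion v t := by
    intro t ht htv
    have := hmin (j := t * v) ⟨u * t⁻¹, H.mul_mem hu (H.inv_mem ht), by rw [hw]; group⟩ htv.2.le
    exact absurd htv.2 (by omega)
  have key : ∀ n a b, cs.simple a ∈ H → cs.simple b ∈ H → a ≠ b → (M a b = 0 ∨ n ≤ M a b) →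
      cs.IsReduced (altWord a b n) ∧ cs.IsReducedMul (cs.wordProd (altWord a b n)) v := by
    intro n
    induction n with
    | zero =>
      intro a b _ _ _ _
      exact ⟨by simp [IsReduced, altWord], by simp [altWord, isReducedMul_one_left]⟩
    | succ n ih =>
      intro a b ha hb hab hn
      obtain ⟨h1, h2⟩ := ih b a hb ha hab.symm (by rw [M.symmetric b a]; omega)
      have hna : ¬ cs.IsLeftInversion (cs.wordProd (altWord b a n)) (cs.simple a) :=
        not_isLeftInversion_altWord hab.symm (by rw [M.symmetric b a]; omega)
      have hmem : cs.wordProd (altWord b a n) ∈ H := wordProd_altWord_mem hb ha n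
      have h3 : cs.IsReducedMul (cs.simple a) (cs.wordProd (altWord b a n)) :=
        isReducedMul_simple_left.mpr hna
      have h4 : cs.IsReducedMul (cs.simple a) (cs.wordProd (altWord b a n) * v) := by
        rw [isReducedMul_simple_left, cs.isLeftInversion_mul_iff (cs.isReflection_simple a)]
        intro h
        exact h.or.elim hna (hv _ (H.mul_mem (H.mul_mem (H.inv_mem hmem) ha) hmem))
      rw [altWord, isReduced_cons_iff, wordProd_cons]
      exact ⟨⟨h1, h3⟩, (isReducedMul_assoc.mpr ⟨h2, h4⟩).2⟩
  have hui : ∀ t ∈ H, cs.IsLeftInversion w t → cs.IsLeftInversion u t := by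
    intro t ht h
    rw [hw, cs.isLeftInversion_mul_iff h.1] at h
    exact h.or.resolve_right (hv _ (H.mul_mem (H.mul_mem (H.inv_mem hu) ht) hu))
  obtain ⟨n, hn, hun⟩ := exists_altWord_of_mem_closure hu
  have hnm : ¬ (M i j = 0 ∨ n < M i j) := by
    intro hlt
    rcases hun with rfl | rfl
    · exact not_isLeftInversion_altWord hij hlt (hui _ hjH hj)
    · exact not_isLeftInversion_altWord hij.symm (by rwa [M.symmetric j i]) (hui _ hiH hi)
  have hn' : n = M i j := by omega
  have hun' : u = cs.wordProd (altWord i j (M i j)) := by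
    rw [hn', ← wordProd_altWord_comm, or_self] at hun
    exact hun
  obtain ⟨h1, h2⟩ := key (M i j) i j hiH hjH hij (by omega)
  exact ⟨by omega, h1, v, h2, hun' ▸ hw⟩

variable (cs) in
/-- In a finite Coxeter group there is an element above all others in the weak order. -/
theorem exists_longest [Finite W] : ∃ w₀ : W, ∀ w, cs.WeakLE w w₀ := by
  obtain ⟨w₀, hw₀⟩ := Finite.exists_max cs.length
  refine ⟨w₀, fun w => ?_⟩
  have hrefl : ∀ t, cs.IsReflection t → cs.IsLeftInversion w₀ t := fun t ht =>
    ⟨ht, lt_of_le_of_ne (hw₀ _) (ht.length_mul_right_ne w₀)⟩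
  induction hn : cs.length w generalizing w with
  | zero => rw [cs.length_eq_zero_iff.mp hn]; exact one_weakLE w₀
  | succ n ih =>
    have hne : w ≠ 1 := by rintro rfl; simp at hn
    obtain ⟨i, hi⟩ := cs.exists_rightDescent_of_ne_one hne
    rw [isRightDescent_iff] at hi
    obtain ⟨v, rfl⟩ : ∃ v, w = v * cs.simple i := ⟨w * cs.simple i, by simp⟩
    rw [simple_mul_simple_cancel_right] at hi
    obtain ⟨c, hc, hcw⟩ := ih v (by omega)
    -- the reflection `v * s * v⁻¹` inverts the longest element but not `v`
    have ht : cs.IsReflection (v * cs.simple i * v⁻¹) := ⟨v, i, rfl⟩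
    have h := hrefl _ ht
    rw [hcw, cs.isLeftInversion_mul_iff ht] at h
    have hs : cs.IsLeftInversion c (cs.simple i) := by
      have := h.or.resolve_left (fun h' => by
        have := h'.2
        rw [inv_mul_cancel_right] at this
        omega)
      simpa [mul_assoc] using this
    rw [← simple_weakLE_iff] at hs
    exact hcw ▸ (hs.mul_left hc).1

variable {w₀ : W}

theorem longest_inv (hw₀ : ∀ w, cs.WeakLE w w₀) : w₀⁻¹ = w₀ :=
  (hw₀ w₀⁻¹).eq_of_length_le (by rw [length_inv])

/-- The longest element is the only one that has all simple generators as left descents. -/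
theorem eq_longest (hw₀ : ∀ w, cs.WeakLE w w₀) {w : W} (h : ∀ i, cs.WeakLE (cs.simple i) w) :
    w = w₀ := by
  obtain ⟨c, hc, hwc⟩ := hw₀ w⁻¹
  have hw : w₀ = c⁻¹ * w := by rw [← longest_inv hw₀, hwc]; group
  by_cases h1 : c = 1
  · simp [hw, h1]
  obtain ⟨i, d, hd, rfl⟩ := exists_simple_weakLE (cs := cs) h1
  have h2 := (isReducedMul_assoc.mpr ⟨hd, hc⟩).1
  rw [← inv_simple, isReducedMul_inv, isReducedMul_simple_left, ← simple_weakLE_iff] at h2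
  exact absurd (h i) h2

end CoxeterSystem

/-! ### Least common multiples from those of atoms -/

section PartialLcm

variable {P : Type*} [Monoid P]

/-- Left divisibility `b = a * c`, where only those products `a * c` count for which `D a c`
holds. -/
def DvdWith (D : P → P → Prop) (a b : P) : Prop := ∃ c, D a c ∧ b = a * c

/-- `z` is a least upper bound of `a` and `b` for `DvdWith D`. -/
def IsJoinWith (D : P → P → Prop) (a b z : P) : Prop :=
  DvdWith D a z ∧ DvdWith D b z ∧ ∀ y, DvdWith D a y → DvdWith D b y → DvdWith D z y

/-- Least common multiples exist as soon as atoms have them. The product is allowed to be partial: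
`D a b` says that the product of `a` and `b` counts. With the reduced products this is used for the
weak order of a Coxeter group, and with all products for its Artin monoid. -/
theorem exists_isJoinWith {D : P → P → Prop} {len : P → ℕ} {A : Set P}
    (one_right : ∀ a, D a 1) (one_left : ∀ a, D 1 a)
    (assoc : ∀ a b c, D a b ∧ D (a * b) c ↔ D b c ∧ D a (b * c))
    (cancel : ∀ a b c, D a b → D a c → a * b = a * c → b = c)
    (len_mul : ∀ a b, D a b → len (a * b) = len a + len b)
    (len_pos : ∀ a ∈ A, 0 < len a)
    (factor : ∀ a, a ≠ 1 → ∃ s ∈ A, DvdWith D s a)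
    (atoms : ∀ s ∈ A, ∀ t ∈ A, ∀ x, DvdWith D s x → DvdWith D t x → ∃ z, IsJoinWith D s t z)
    {a b x : P} (ha : DvdWith D a x) (hb : DvdWith D b x) : ∃ z, IsJoinWith D a b z := by
  have refl : ∀ a, DvdWith D a a := fun a => ⟨1, one_right a, (mul_one a).symm⟩
  have one_dvd : ∀ a, DvdWith D 1 a := fun a => ⟨a, one_left a, (one_mul a).symm⟩
  have trans : ∀ {a b c}, DvdWith D a b → DvdWith D b c → DvdWith D a c := by
    rintro a b c ⟨d, hd, rfl⟩ ⟨e, he, rfl⟩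
    exact ⟨d * e, ((assoc _ _ _).mp ⟨hd, he⟩).2, mul_assoc _ _ _⟩
  have mul_dvd : ∀ {a b c}, D a c → DvdWith D b c → D a b ∧ DvdWith D (a * b) (a * c) := by
    rintro a b c hc ⟨d, hd, rfl⟩
    obtain ⟨h1, h2⟩ := (assoc _ _ _).mpr ⟨hd, hc⟩
    exact ⟨h1, d, h2, (mul_assoc _ _ _).symm⟩
  have dvd_of_mul : ∀ {a b c}, D a b → D a c → DvdWith D (a * b) (a * c) → DvdWith D b c := by
    rintro a b c hb hc ⟨d, hd, h⟩
    obtain ⟨h1, h2⟩ := (assoc _ _ _).mp ⟨hb, hd⟩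
    exact ⟨d, h1, cancel _ _ _ hc h2 (by rw [h, mul_assoc])⟩
  induction hn : len x using Nat.strong_induction_on generalizing a b x with
  | _ n ih =>
  by_cases ha1 : a = 1
  · exact ⟨b, ha1 ▸ one_dvd b, refl b, fun y _ h => h⟩
  by_cases hb1 : b = 1
  · exact ⟨a, refl a, hb1 ▸ one_dvd a, fun y h _ => h⟩
  obtain ⟨s, hs, a', hsa, rfl⟩ := factor a ha1
  obtain ⟨t, ht, b', htb, rfl⟩ := factor b hb1
  have hsx : DvdWith D s x := trans ⟨a', hsa, rfl⟩ ha
  have htx : DvdWith D t x := trans ⟨b', htb, rfl⟩ hb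
  obtain ⟨m, ⟨p, hp, hmp⟩, ⟨q, hq, hmq⟩, hm⟩ := atoms s hs t ht x hsx htx
  -- `s p = m = t q` is the join of the atoms; what is left to join are two elements beyond it
  have aux : ∀ {s a' p : P}, s ∈ A → D s a' → D s p → m = s * p → DvdWith D (s * a') x →
      DvdWith D m x → ∃ u, D p u ∧ D m u ∧ DvdWith D (m * u) x ∧
        ∀ y, D m y → (DvdWith D (s * a') (m * y) ↔ DvdWith D u y) := by
    intro s a' p hs hsa hp hmp hax hmx
    obtain ⟨x₁, hsx₁, rfl⟩ := trans ⟨a', hsa, rfl⟩ hax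
    obtain ⟨z, haz, ⟨u, hu, rfl⟩, hz⟩ := ih (len x₁)
      (by rw [← hn, len_mul _ _ hsx₁]; have := len_pos s hs; omega)
      (dvd_of_mul hsa hsx₁ hax) (dvd_of_mul hp hsx₁ (hmp ▸ hmx)) rfl
    have hzx : DvdWith D (p * u) x₁ :=
      hz _ (dvd_of_mul hsa hsx₁ hax) (dvd_of_mul hp hsx₁ (hmp ▸ hmx))
    obtain ⟨hspu, hspux⟩ := mul_dvd hsx₁ hzx
    subst hmp
    refine ⟨u, hu, ((assoc _ _ _).mpr ⟨hu, hspu⟩).2, by rwa [mul_assoc], fun y hy => ?_⟩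
    obtain ⟨hpy, hspy⟩ := (assoc _ _ _).mp ⟨hp, hy⟩
    rw [mul_assoc]
    exact ⟨fun h => dvd_of_mul hu hpy (hz _ (dvd_of_mul hsa hspy h) ⟨y, hpy, rfl⟩),
      fun h => (mul_dvd hspy (trans haz (mul_dvd hpy h).2)).2⟩
  have hmx := hm x hsx htx
  obtain ⟨u, -, hmu, hux, hu⟩ := aux hs hsa hp hmp ha hmx
  obtain ⟨v, -, hmv, hvx, hv⟩ := aux ht htb hq hmq hb hmx
  obtain ⟨x₃, hx₃, rfl⟩ := hmx
  have hlen : len x₃ < n := by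
    have := len_pos s hs
    rw [← hn, len_mul _ _ hx₃, hmp, len_mul _ _ hp]
    omega
  have hux₃ := dvd_of_mul hmu hx₃ hux
  have hvx₃ := dvd_of_mul hmv hx₃ hvx
  obtain ⟨w, huw, hvw, hw⟩ := ih _ hlen hux₃ hvx₃ rfl
  have hmw : D m w := (mul_dvd hx₃ (hw _ hux₃ hvx₃)).1
  refine ⟨m * w, (hu w hmw).mpr huw, (hv w hmw).mpr hvw, fun y hay hby => ?_⟩
  obtain ⟨y₃, hy₃, rfl⟩ := hm y (trans ⟨a', hsa, rfl⟩ hay) (trans ⟨b', htb, rfl⟩ hby)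
  exact (mul_dvd hy₃ (hw y₃ ((hu y₃ hy₃).mp hay) ((hv y₃ hy₃).mp hby))).2

end PartialLcm

namespace CoxeterSystem

variable {B W : Type*} [Group W] {M : CoxeterMatrix B} {cs : CoxeterSystem M W}

/-! ### Joins in the weak order -/

/-- Two elements with a common upper bound in the weak order have a join. -/
theorem exists_weakLE_join {a b x : W} (ha : cs.WeakLE a x) (hb : cs.WeakLE b x) :
    ∃ z, cs.WeakLE a z ∧ cs.WeakLE b z ∧ ∀ y, cs.WeakLE a y → cs.WeakLE b y → cs.WeakLE z y := by
  refine exists_isJoinWith (D := cs.IsReducedMul) (len := cs.length) (A := Set.range cs.simple)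
    isReducedMul_one_right isReducedMul_one_left (fun _ _ _ => isReducedMul_assoc)
    (fun _ _ _ _ _ h => mul_left_cancel h) (fun _ _ h => h) ?_ ?_ ?_ ha hb
  · rintro _ ⟨i, rfl⟩
    simp
  · intro w hw
    obtain ⟨i, hi⟩ := exists_simple_weakLE hw
    exact ⟨_, ⟨i, rfl⟩, hi⟩
  · rintro _ ⟨i, rfl⟩ _ ⟨j, rfl⟩ x hi hj
    rcases eq_or_ne i j with rfl | hij
    · exact ⟨cs.simple i, weakLE_refl _, weakLE_refl _, fun y h _ => h⟩
    obtain ⟨h0, hr, -⟩ := altWord_weakLE hij hi hj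
    have hpre : ∀ a b, M a b ≠ 0 → cs.IsReduced (altWord a b (M a b)) →
        cs.WeakLE (cs.simple a) (cs.wordProd (altWord a b (M a b))) := by
      intro a b h0 hr
      obtain ⟨n, hn⟩ := Nat.exists_eq_succ_of_ne_zero h0
      rw [hn, altWord] at hr ⊢
      exact ⟨_, (isReduced_cons_iff.mp hr).2, wordProd_cons _ _ _⟩
    refine ⟨cs.wordProd (altWord i j (M i j)), hpre i j h0 hr, ?_,
      fun y hiy hjy => (altWord_weakLE hij hiy hjy).2.2⟩
    rw [wordProd_altWord_comm, M.symmetric i j]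
    exact hpre j i (M.symmetric i j ▸ h0) (altWord_weakLE hij.symm hj hi).2.1

/-- The elements that have a reduced product with `u` are those below `u⁻¹ * w₀`. In particular they
are closed under joins. -/
theorem isReducedMul_iff_weakLE {w₀ : W} (hw₀ : ∀ w, cs.WeakLE w w₀) {u v : W} :
    cs.IsReducedMul u v ↔ cs.WeakLE v (u⁻¹ * w₀) := by
  constructor
  · intro h
    obtain ⟨c, hc, hw⟩ := hw₀ (u * v)
    exact ⟨c, (isReducedMul_assoc.mp ⟨h, hc⟩).1, by rw [hw]; group⟩
  · intro h
    exact (h.mul_left (hw₀ u).isReducedMul).2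

variable (cs) [Finite W]

/-- Among the `v ≤ w` such that `u * v` is reduced there is a largest one. -/
theorem exists_maxReduced (u w : W) : ∃ v, cs.WeakLE v w ∧ cs.IsReducedMul u v ∧
    ∀ y, cs.WeakLE y w → cs.IsReducedMul u y → cs.WeakLE y v := by
  obtain ⟨w₀, hw₀⟩ := cs.exists_longest
  obtain ⟨v, ⟨hv, huv⟩, hmax⟩ := Set.exists_max_image
    {v | cs.WeakLE v w ∧ cs.IsReducedMul u v} cs.length (Set.toFinite _)
    ⟨1, one_weakLE w, isReducedMul_one_right u⟩
  refine ⟨v, hv, huv, fun y hy huy => ?_⟩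
  obtain ⟨z, hvz, hyz, hz⟩ := exists_weakLE_join hv hy
  have hzu : cs.IsReducedMul u z := (isReducedMul_iff_weakLE hw₀).mpr
    (hz _ ((isReducedMul_iff_weakLE hw₀).mp huv) ((isReducedMul_iff_weakLE hw₀).mp huy))
  rwa [hvz.eq_of_length_le (hmax z ⟨hz w hv hy, hzu⟩)]

/-- The largest `v ≤ w` such that `u * v` is reduced. -/
noncomputable def maxReduced (u w : W) : W := (cs.exists_maxReduced u w).choose

theorem maxReduced_weakLE (u w : W) : cs.WeakLE (cs.maxReduced u w) w :=
  (cs.exists_maxReduced u w).choose_spec.1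

theorem isReducedMul_maxReduced (u w : W) : cs.IsReducedMul u (cs.maxReduced u w) :=
  (cs.exists_maxReduced u w).choose_spec.2.1

theorem weakLE_maxReduced {u w y : W} (hy : cs.WeakLE y w) (huy : cs.IsReducedMul u y) :
    cs.WeakLE y (cs.maxReduced u w) :=
  (cs.exists_maxReduced u w).choose_spec.2.2 y hy huy

theorem maxReduced_eq {u w v : W} (hv : cs.WeakLE v w) (huv : cs.IsReducedMul u v)
    (h : ∀ y, cs.WeakLE y w → cs.IsReducedMul u y → cs.WeakLE y v) : cs.maxReduced u w = v :=
  (h _ (cs.maxReduced_weakLE u w) (cs.isReducedMul_maxReduced u w)).antisymm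
    (cs.weakLE_maxReduced hv huv)

theorem maxReduced_one_left (w : W) : cs.maxReduced 1 w = w :=
  cs.maxReduced_eq (weakLE_refl w) (isReducedMul_one_left w) fun _ hy _ => hy

/-- The rule that makes `w ↦ u * maxReduced u w` compatible with reduced products. -/
theorem maxReduced_mul {u u' : W} (huu' : cs.IsReducedMul u u') (w : W) :
    cs.maxReduced u (u' * cs.maxReduced u' w) = u' * cs.maxReduced (u * u') w := by
  obtain ⟨w₀, hw₀⟩ := cs.exists_longest
  have hv := cs.maxReduced_weakLE (u * u') w
  obtain ⟨hu'v, huu'v⟩ := isReducedMul_assoc.mp ⟨huu', cs.isReducedMul_maxReduced (u * u') w⟩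
  have hu'v' := cs.isReducedMul_maxReduced u' w
  have hle : cs.WeakLE u' (u' * cs.maxReduced u' w) := ⟨_, hu'v', rfl⟩
  refine cs.maxReduced_eq ((cs.weakLE_maxReduced hv hu'v).mul_left hu'v').1 huu'v
    fun y hy huy => ?_
  -- the join of `u'` and `y` is a multiple of `u'`, and it still has a reduced product with `u`
  obtain ⟨z, ⟨e, hu'e, rfl⟩, hyz, hz⟩ := exists_weakLE_join hle hy
  have huz : cs.IsReducedMul u (u' * e) := (isReducedMul_iff_weakLE hw₀).mpr
    (hz _ ((isReducedMul_iff_weakLE hw₀).mp huu') ((isReducedMul_iff_weakLE hw₀).mp huy))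
  have he : cs.WeakLE e w :=
    (weakLE_of_mul_left hu'e (hz _ hle hy)).trans (cs.maxReduced_weakLE u' w)
  exact hyz.trans
    ((cs.weakLE_maxReduced he (isReducedMul_assoc.mpr ⟨hu'e, huz⟩).2).mul_left hu'v).1

end CoxeterSystem

namespace Artin

open CoxeterSystem

variable {B W : Type*} [Group W] {Γ : CoxeterMatrix B}

/-! ### The positive lift of a Coxeter group -/

/-- The element of the Artin monoid spelled by a word. -/
def wordGen (Γ : CoxeterMatrix B) (ω : List B) : ArtinMonoid Γ := (ω.map (gen Γ)).prod

theorem wordGen_cons (i : B) (ω : List B) : wordGen Γ (i :: ω) = gen Γ i * wordGen Γ ω := by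
  simp [wordGen]

theorem wordGen_append (ω ω' : List B) :
    wordGen Γ (ω ++ ω') = wordGen Γ ω * wordGen Γ ω' := by
  simp [wordGen]

theorem mk_ofList (ω : List B) :
    PresentedMonoid.mk (monoidRels Γ) (FreeMonoid.ofList ω) = wordGen Γ ω := by
  induction ω with
  | nil => simp [wordGen]
  | cons i ω ih => rw [FreeMonoid.ofList_cons, map_mul, ih, wordGen_cons]; rfl

theorem wordGen_surjective : Function.Surjective (wordGen Γ) := fun x => by
  obtain ⟨ω, rfl⟩ := PresentedMonoid.surjective_mk x
  exact ⟨ω.toList, (mk_ofList _).symm⟩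

theorem lift_ofList {P : Type*} [Monoid P] (f : B → P) (ω : List B) :
    FreeMonoid.lift f (FreeMonoid.ofList ω) = (ω.map f).prod := by
  simp [FreeMonoid.lift_apply]

/-- Induction on elements of the Artin monoid, by multiplying generators on the left. -/
theorem gen_induction {p : ArtinMonoid Γ → Prop} (x : ArtinMonoid Γ) (one : p 1)
    (mul : ∀ i x, p x → p (gen Γ i * x)) : p x := by
  obtain ⟨ω, rfl⟩ := wordGen_surjective x
  induction ω with
  | nil => simpa [wordGen] using one
  | cons i ω ih => rw [wordGen_cons]; exact mul i _ ih

theorem wordGen_altWord_comm {i j : B} (h : Γ i j ≠ 0) :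
    wordGen Γ (altWord i j (Γ i j)) = wordGen Γ (altWord j i (Γ i j)) := by
  have : wordGen Γ (braidWord Γ i j) = wordGen Γ (braidWord Γ j i) := by
    rw [← mk_ofList, ← mk_ofList]
    exact PresentedMonoid.mk_eq_mk_of_rel ⟨i, j, h, rfl, rfl⟩
  rw [braidWord, braidWord, Γ.symmetric j i, alternatingWord_eq_altWord,
    alternatingWord_eq_altWord] at this
  split_ifs at this
  exacts [this, this.symm]

/-- Matsumoto's theorem: two reduced words for the same element of the Coxeter group spell the same
element of the Artin monoid. -/
theorem wordGen_eq_of_isReduced (cs : CoxeterSystem Γ W) {ω ω' : List B} (hω : cs.IsReduced ω)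
    (hω' : cs.IsReduced ω') (h : cs.wordProd ω = cs.wordProd ω') :
    wordGen Γ ω = wordGen Γ ω' := by
  have hlen : ω.length = ω'.length := by rw [← hω.eq, h, hω'.eq]
  induction hn : ω.length generalizing ω ω' with
  | zero =>
    rw [List.length_eq_zero_iff.mp hn, List.length_eq_zero_iff.mp (hlen.symm.trans hn)]
  | succ n ih =>
    obtain ⟨i, ω, rfl⟩ := List.exists_cons_of_length_eq_add_one hn
    obtain ⟨j, ω', rfl⟩ := List.exists_cons_of_length_eq_add_one (hlen ▸ hn)
    obtain ⟨hω1, hi⟩ := isReduced_cons_iff.mp hω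
    obtain ⟨hω1', hj⟩ := isReduced_cons_iff.mp hω'
    simp only [List.length_cons, Nat.add_right_cancel_iff] at hlen hn
    rw [wordProd_cons, wordProd_cons] at h
    rw [wordGen_cons, wordGen_cons]
    rcases eq_or_ne i j with rfl | hij
    · rw [ih hω1 hω1' (mul_left_cancel h) hlen hn]
    obtain ⟨h0, hr, c, hc, hw⟩ := altWord_weakLE hij ⟨_, hi, rfl⟩ ⟨_, hj, h⟩
    have hr' := (altWord_weakLE hij.symm ⟨_, hj, h⟩ ⟨_, hi, rfl⟩).2.1
    rw [Γ.symmetric j i] at hr'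
    obtain ⟨ν, hν, rfl⟩ := cs.exists_isReduced c
    have hb := wordGen_altWord_comm h0
    have hbW := cs.wordProd_altWord_comm i j
    obtain ⟨m, hm⟩ := Nat.exists_eq_succ_of_ne_zero h0
    rw [hm] at hr hr' hw hc hb hbW
    have h1 := isReduced_append hr hν hc
    have h2 := isReduced_append hr' hν (hbW ▸ hc)
    have hw' := h.symm.trans hw
    rw [hbW] at hw'
    rw [← wordProd_append] at hw hw'
    simp only [altWord, List.cons_append, wordProd_cons, mul_right_inj] at h1 h2 hw hw'
    rw [ih hω1 (isReduced_cons_iff.mp h1).1 hw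
        (by rw [← hω1.eq, hw, (isReduced_cons_iff.mp h1).1.eq]) hn,
      ih hω1' (isReduced_cons_iff.mp h2).1 hw'
        (by rw [← hω1'.eq, hw', (isReduced_cons_iff.mp h2).1.eq]) (hlen ▸ hn),
      ← wordGen_cons, ← wordGen_cons, ← List.cons_append, ← List.cons_append, wordGen_append,
      wordGen_append]
    exact congrArg (· * _) hb

/-- The element of the Artin monoid spelled by the reduced words for `w`. -/
noncomputable def posLift (cs : CoxeterSystem Γ W) (w : W) : ArtinMonoid Γ :=
  wordGen Γ (cs.exists_isReduced w).choose

variable (cs : CoxeterSystem Γ W)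

theorem posLift_wordProd {ω : List B} (hω : cs.IsReduced ω) :
    posLift cs (cs.wordProd ω) = wordGen Γ ω :=
  have h := (cs.exists_isReduced (cs.wordProd ω)).choose_spec
  wordGen_eq_of_isReduced cs h.1 hω h.2.symm

theorem posLift_mul {u v : W} (h : cs.IsReducedMul u v) :
    posLift cs (u * v) = posLift cs u * posLift cs v := by
  obtain ⟨ω, hω, rfl⟩ := cs.exists_isReduced u
  obtain ⟨ω', hω', rfl⟩ := cs.exists_isReduced v
  rw [← wordProd_append, posLift_wordProd cs (isReduced_append hω hω' h), posLift_wordProd cs hω,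
    posLift_wordProd cs hω', wordGen_append]

theorem posLift_one : posLift cs 1 = 1 := by
  have h : cs.IsReduced [] := by simp [CoxeterSystem.IsReduced]
  simpa [wordGen] using posLift_wordProd cs h

theorem posLift_simple (i : B) : posLift cs (cs.simple i) = gen Γ i := by
  have h : cs.IsReduced [i] := by simp [CoxeterSystem.IsReduced]
  simpa [wordGen] using posLift_wordProd cs h

theorem posLift_dvd {u w : W} (h : cs.WeakLE u w) : posLift cs u ∣ posLift cs w := by
  obtain ⟨c, hc, rfl⟩ := h
  exact ⟨_, posLift_mul cs hc⟩

theorem isReduced_altWord [Finite W] {i j : B} (h : Γ i j ≠ 0) :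
    cs.IsReduced (altWord i j (Γ i j)) := by
  obtain ⟨w₀, hw₀⟩ := cs.exists_longest
  rcases eq_or_ne i j with rfl | hij
  · simp [altWord, CoxeterSystem.IsReduced]
  · exact (altWord_weakLE hij (hw₀ _) (hw₀ _)).2.1

theorem isReduced_braidWord [Finite W] {i j : B} (h : Γ i j ≠ 0) :
    cs.IsReduced (braidWord Γ i j) := by
  rw [braidWord, alternatingWord_eq_altWord]
  split_ifs
  · exact isReduced_altWord cs h
  · rw [Γ.symmetric i j] at h ⊢
    exact isReduced_altWord cs h

/-! ### The greatest simple divisor, and cancellation -/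

variable [Finite W]

/-- Left multiplication by the positive lift of `u`, on pairs `(w, y)` that stand for the product of
the positive lift of `w` with `y`. As much of `w` is kept in the first entry as is possible. -/
noncomputable def pairAct (u : W) : Function.End (W × ArtinMonoid Γ) := fun p =>
  (u * cs.maxReduced u p.1, posLift cs ((cs.maxReduced u p.1)⁻¹ * p.1) * p.2)

theorem pairAct_one : pairAct cs 1 = 1 := by
  funext p
  simp [pairAct, maxReduced_one_left, posLift_one, Function.End.one_def]

theorem pairAct_mul {u v : W} (h : cs.IsReducedMul u v) :
    pairAct cs (u * v) = pairAct cs u * pairAct cs v := by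
  funext p
  rw [Function.End.mul_apply']
  simp only [pairAct, maxReduced_mul cs h, mul_assoc]
  refine Prod.ext rfl ?_
  have hle : cs.WeakLE (cs.maxReduced (u * v) p.1) (cs.maxReduced v p.1) :=
    cs.weakLE_maxReduced (cs.maxReduced_weakLE _ _)
      (isReducedMul_assoc.mp ⟨h, cs.isReducedMul_maxReduced (u * v) p.1⟩).1
  obtain ⟨c, hc, hvc⟩ := hle
  obtain ⟨d, hd, hpd⟩ := cs.maxReduced_weakLE v p.1
  rw [hvc] at hd
  have hcd := (isReducedMul_assoc.mp ⟨hc, hd⟩).1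
  have h1 : (cs.maxReduced (u * v) p.1)⁻¹ * p.1 = c * d := by
    nth_rewrite 2 [hpd]; rw [hvc]; group
  have h2 : (cs.maxReduced v p.1)⁻¹ * p.1 = d := by
    nth_rewrite 2 [hpd]; group
  have h3 : (v * cs.maxReduced (u * v) p.1)⁻¹ * (v * cs.maxReduced v p.1) = c := by
    rw [hvc]; group
  simp only [h1, h2, h3, posLift_mul cs hcd, mul_assoc]

theorem pairAct_wordProd {ω : List B} (hω : cs.IsReduced ω) :
    (ω.map fun i => pairAct cs (cs.simple i)).prod = pairAct cs (cs.wordProd ω) := by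
  induction ω with
  | nil => simp [pairAct_one]
  | cons i ω ih =>
    obtain ⟨h1, h2⟩ := isReduced_cons_iff.mp hω
    rw [List.map_cons, List.prod_cons, ih h1, wordProd_cons, pairAct_mul cs h2]

theorem pairAct_rels (x y : FreeMonoid B) (h : monoidRels Γ x y) :
    FreeMonoid.lift (fun i => pairAct cs (cs.simple i)) x =
      FreeMonoid.lift (fun i => pairAct cs (cs.simple i)) y := by
  obtain ⟨i, j, h, rfl, rfl⟩ := h
  rw [lift_ofList, lift_ofList, pairAct_wordProd cs (isReduced_braidWord cs h),
    pairAct_wordProd cs (isReduced_braidWord cs (Γ.symmetric i j ▸ h)), wordProd_braidWord_eq]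

/-- The action of the Artin monoid on pairs by left multiplication. -/
noncomputable def pairHom : ArtinMonoid Γ →* Function.End (W × ArtinMonoid Γ) :=
  PresentedMonoid.lift (fun i => pairAct cs (cs.simple i)) (pairAct_rels cs)

/-- The greatest divisor of `x` among the positive lifts of elements of `W`. -/
noncomputable def head (x : ArtinMonoid Γ) : W := (pairHom cs x (1, 1)).1

/-- The quotient of `x` by its head. -/
noncomputable def tail (x : ArtinMonoid Γ) : ArtinMonoid Γ := (pairHom cs x (1, 1)).2

theorem pairHom_wordGen {ω : List B} (hω : cs.IsReduced ω) :
    pairHom cs (wordGen Γ ω) = pairAct cs (cs.wordProd ω) := by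
  rw [← pairAct_wordProd cs hω, ← lift_ofList, ← mk_ofList]
  rfl

theorem pairHom_posLift (u : W) : pairHom cs (posLift cs u) = pairAct cs u := by
  obtain ⟨ω, hω, rfl⟩ := cs.exists_isReduced u
  rw [posLift_wordProd cs hω, pairHom_wordGen cs hω]

theorem head_posLift_mul (u : W) (x : ArtinMonoid Γ) :
    head cs (posLift cs u * x) = u * cs.maxReduced u (head cs x) := by
  rw [head, map_mul, Function.End.mul_apply', pairHom_posLift]
  rfl

theorem tail_posLift_mul (u : W) (x : ArtinMonoid Γ) :
    tail cs (posLift cs u * x) =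
      posLift cs ((cs.maxReduced u (head cs x))⁻¹ * head cs x) * tail cs x := by
  rw [tail, map_mul, Function.End.mul_apply', pairHom_posLift]
  rfl

theorem posLift_maxReduced_mul (u w : W) : posLift cs (cs.maxReduced u w) *
    posLift cs ((cs.maxReduced u w)⁻¹ * w) = posLift cs w := by
  rw [← posLift_mul cs (cs.maxReduced_weakLE u w).isReducedMul, mul_inv_cancel_left]

theorem head_mul_tail (x : ArtinMonoid Γ) : posLift cs (head cs x) * tail cs x = x := by
  induction x using gen_induction with
  | one => simp [head, tail, posLift_one, Function.End.one_def]
  | mul i x ih =>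
    rw [← posLift_simple cs, head_posLift_mul, tail_posLift_mul,
      posLift_mul cs (cs.isReducedMul_maxReduced _ _), mul_assoc, ← mul_assoc (posLift cs _)
      (posLift cs _) (tail cs x), posLift_maxReduced_mul, ih]

theorem posLift_dvd_iff {w : W} {x : ArtinMonoid Γ} :
    posLift cs w ∣ x ↔ cs.WeakLE w (head cs x) := by
  constructor
  · rintro ⟨y, rfl⟩
    rw [head_posLift_mul]
    exact ⟨_, cs.isReducedMul_maxReduced _ _, rfl⟩
  · intro h
    exact (posLift_dvd cs h).trans ⟨_, (head_mul_tail cs x).symm⟩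

/-- The head and the tail of `u * y` determine `y`. -/
theorem eq_of_posLift_mul (u : W) (y : ArtinMonoid Γ) :
    y = posLift cs (u⁻¹ * head cs (posLift cs u * y)) * tail cs (posLift cs u * y) := by
  rw [head_posLift_mul, inv_mul_cancel_left, tail_posLift_mul, ← mul_assoc,
    posLift_maxReduced_mul, head_mul_tail]

theorem mul_left_cancel_artin (cs : CoxeterSystem Γ W) (a : ArtinMonoid Γ) {x y : ArtinMonoid Γ}
    (h : a * x = a * y) : x = y := by
  induction a using gen_induction with
  | one => simpa using h
  | mul i a ih =>
    refine ih ?_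
    rw [mul_assoc, mul_assoc, ← posLift_simple cs] at h
    rw [eq_of_posLift_mul cs (cs.simple i) (a * x), h, ← eq_of_posLift_mul]

end Artin

namespace Artin

open CoxeterSystem

variable {B W : Type*} [Group W] {Γ : CoxeterMatrix B}

/-! ### Word length, reversal and least common multiples in the Artin monoid -/

/-- The word length, which is additive because the braid relations are homogeneous. -/
def wordLengthHom (Γ : CoxeterMatrix B) : ArtinMonoid Γ →* Multiplicative ℕ :=
  PresentedMonoid.lift (fun _ => Multiplicative.ofAdd 1) fun x y h => by
    obtain ⟨i, j, -, rfl, rfl⟩ := h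
    simp [Γ.symmetric j i]

/-- The word length of an element of the Artin monoid. -/
def wordLength (x : ArtinMonoid Γ) : ℕ := (wordLengthHom Γ x).toAdd

theorem wordLength_mul (x y : ArtinMonoid Γ) :
    wordLength (x * y) = wordLength x + wordLength y := by
  simp [wordLength]

theorem wordLength_gen (i : B) : wordLength (gen Γ i) = 1 := by
  simp [wordLength, wordLengthHom, gen]

theorem eq_one_of_wordLength_eq_zero {x : ArtinMonoid Γ} (h : wordLength x = 0) : x = 1 := by
  induction x using gen_induction with
  | one => rfl
  | mul i x _ => rw [wordLength_mul, wordLength_gen] at h; omega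

theorem dvd_antisymm_artin {x y : ArtinMonoid Γ} (hxy : x ∣ y) (hyx : y ∣ x) : x = y := by
  obtain ⟨c, rfl⟩ := hxy
  obtain ⟨d, hd⟩ := hyx
  have := congrArg wordLength hd
  rw [wordLength_mul, wordLength_mul] at this
  rw [eq_one_of_wordLength_eq_zero (by omega : wordLength c = 0), mul_one]

/-- Two elements of the Artin monoid with a common multiple have a least common multiple. For two
generators it is the positive lift of their join in the weak order. -/
theorem exists_lcm_artin [Finite W] (cs : CoxeterSystem Γ W) {a b x : ArtinMonoid Γ} (ha : a ∣ x)
    (hb : b ∣ x) : ∃ z, a ∣ z ∧ b ∣ z ∧ ∀ y, a ∣ y → b ∣ y → z ∣ y := by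
  have hD : ∀ a b : ArtinMonoid Γ, DvdWith (fun _ _ => True) a b ↔ a ∣ b := by
    intro a b
    simp [DvdWith, Dvd.dvd]
  have := exists_isJoinWith (D := fun _ _ : ArtinMonoid Γ => True) (len := wordLength)
    (A := Set.range (gen Γ)) (a := a) (b := b) (x := x) (fun _ => trivial) (fun _ => trivial)
    (fun _ _ _ => Iff.rfl) (fun a _ _ _ _ h => mul_left_cancel_artin cs a h)
    (fun a b _ => wordLength_mul a b)
  simp only [IsJoinWith, hD] at this
  refine this ?_ ?_ ?_ ha hb
  · rintro _ ⟨i, rfl⟩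
    simp [wordLength_gen]
  · intro a ha
    induction a using gen_induction with
    | one => exact absurd rfl ha
    | mul i a _ => exact ⟨_, ⟨i, rfl⟩, a, rfl⟩
  · rintro _ ⟨i, rfl⟩ _ ⟨j, rfl⟩ x hi hj
    rw [← posLift_simple cs, posLift_dvd_iff] at hi hj
    obtain ⟨z, hiz, hjz, hz⟩ := exists_weakLE_join hi hj
    simp only [← posLift_simple cs]
    refine ⟨posLift cs z, posLift_dvd cs hiz, posLift_dvd cs hjz, fun y hiy hjy => ?_⟩
    rw [posLift_dvd_iff] at hiy hjy ⊢
    exact hz _ hiy hjy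

theorem op_wordGen_reverse (ω : List B) :
    (ω.map fun i => MulOpposite.op (gen Γ i)).prod = MulOpposite.op (wordGen Γ ω.reverse) := by
  induction ω with
  | nil => simp [wordGen]
  | cons i ω ih => simp [ih, wordGen]

theorem wordGen_reverse (cs : CoxeterSystem Γ W) {ω : List B} (hω : cs.IsReduced ω) :
    wordGen Γ ω.reverse = posLift cs (cs.wordProd ω)⁻¹ := by
  rw [← wordProd_reverse, posLift_wordProd cs ((cs.isReduced_reverse_iff ω).mpr hω)]

theorem reverse_rels [Finite W] (cs : CoxeterSystem Γ W) (x y : FreeMonoid B)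
    (h : monoidRels Γ x y) :
    FreeMonoid.lift (fun i => MulOpposite.op (gen Γ i)) x =
      FreeMonoid.lift (fun i => MulOpposite.op (gen Γ i)) y := by
  obtain ⟨i, j, h, rfl, rfl⟩ := h
  rw [lift_ofList, lift_ofList, op_wordGen_reverse, op_wordGen_reverse,
    wordGen_reverse cs (isReduced_braidWord cs h),
    wordGen_reverse cs (isReduced_braidWord cs (Γ.symmetric i j ▸ h)), wordProd_braidWord_eq]

/-- The Garside element normalizes the monoid. -/
theorem exists_mul_garside {cs : CoxeterSystem Γ W} {w₀ : W} (hw₀ : ∀ w, cs.WeakLE w w₀)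
    (x : ArtinMonoid Γ) : ∃ y, x * posLift cs w₀ = posLift cs w₀ * y := by
  induction x using gen_induction with
  | one => exact ⟨1, by simp⟩
  | mul i x ih =>
    obtain ⟨y, hy⟩ := ih
    -- write `w₀ = s c = c t`, where `t` is again simple because it has length one
    obtain ⟨c, hc, hw⟩ := hw₀ (cs.simple i)
    obtain ⟨t, ht, hw'⟩ := hw₀ c
    have hlen : cs.length t = 1 := by
      have h1 := congrArg cs.length hw
      rw [hw', hc, ht, length_simple] at h1
      omega
    obtain ⟨j, rfl⟩ := cs.length_eq_one_iff.mp hlen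
    have h1 := posLift_mul cs hc
    have h2 := posLift_mul cs ht
    rw [← hw, posLift_simple] at h1
    rw [← hw', posLift_simple] at h2
    refine ⟨gen Γ j * y, ?_⟩
    rw [mul_assoc, hy, ← mul_assoc, ← mul_assoc]
    nth_rewrite 1 [h2]
    rw [← mul_assoc, ← h1]

variable [Finite W] (cs : CoxeterSystem Γ W)

/-- The anti-automorphism of the Artin monoid that fixes the generators. -/
noncomputable def reverse (x : ArtinMonoid Γ) : ArtinMonoid Γ :=
  (PresentedMonoid.lift (fun i => MulOpposite.op (gen Γ i)) (reverse_rels cs) x).unop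

theorem reverse_one : reverse cs 1 = 1 := by simp [reverse]

theorem reverse_mul (x y : ArtinMonoid Γ) :
    reverse cs (x * y) = reverse cs y * reverse cs x := by simp [reverse]

theorem reverse_gen (i : B) : reverse cs (gen Γ i) = gen Γ i := by simp [reverse, gen]

theorem reverse_reverse (x : ArtinMonoid Γ) : reverse cs (reverse cs x) = x := by
  induction x using gen_induction with
  | one => simp [reverse_one]
  | mul i x ih => rw [reverse_mul, reverse_mul, ih, reverse_gen, reverse_gen]

theorem reverse_posLift (w : W) : reverse cs (posLift cs w) = posLift cs w⁻¹ := by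
  obtain ⟨ω, hω, rfl⟩ := cs.exists_isReduced w
  rw [← wordGen_reverse cs hω, posLift_wordProd cs hω]
  clear hω
  induction ω with
  | nil => simp [wordGen, reverse_one]
  | cons i ω ih =>
    rw [wordGen_cons, reverse_mul, ih, reverse_gen, List.reverse_cons, wordGen_append]
    simp [wordGen]

theorem dvd_reverse_iff {x y : ArtinMonoid Γ} : x ∣ reverse cs y ↔ RightDvd (reverse cs x) y := by
  constructor
  · rintro ⟨c, hc⟩
    exact ⟨reverse cs c, by rw [← reverse_mul, ← hc, reverse_reverse]⟩
  · rintro ⟨c, rfl⟩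
    exact ⟨reverse cs c, by rw [reverse_mul, reverse_reverse]⟩

theorem mul_right_cancel_artin (cs : CoxeterSystem Γ W) (a : ArtinMonoid Γ) {x y : ArtinMonoid Γ}
    (h : x * a = y * a) : x = y := by
  rw [← reverse_reverse cs x, ← reverse_reverse cs y,
    mul_left_cancel_artin cs (reverse cs a)
      (by rw [← reverse_mul, ← reverse_mul, h] : reverse cs a * reverse cs x = _ * reverse cs y)]

/-! ### The Garside element -/

variable {cs} {w₀ : W}

theorem dvd_garside (hw₀ : ∀ w, cs.WeakLE w w₀) {x : ArtinMonoid Γ} :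
    posLift cs w₀ ∣ x ↔ ∀ i, gen Γ i ∣ x := by
  simp only [← posLift_simple cs, posLift_dvd_iff]
  exact ⟨fun h i => (hw₀ _).trans h, fun h => eq_longest hw₀ h ▸ weakLE_refl _⟩

theorem reverse_garside (hw₀ : ∀ w, cs.WeakLE w w₀) :
    reverse cs (posLift cs w₀) = posLift cs w₀ := by
  rw [reverse_posLift, longest_inv hw₀]

theorem rightDvd_garside (hw₀ : ∀ w, cs.WeakLE w w₀) {x : ArtinMonoid Γ} :
    RightDvd (posLift cs w₀) x ↔ ∀ i, RightDvd (gen Γ i) x := by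
  rw [← reverse_garside hw₀, ← dvd_reverse_iff, dvd_garside hw₀]
  refine forall_congr' fun i => ?_
  rw [dvd_reverse_iff, reverse_gen]

theorem isGarsideElement_posLift (hw₀ : ∀ w, cs.WeakLE w w₀) :
    IsGarsideElement Γ Set.univ (posLift cs w₀) := by
  refine ⟨⟨?_, fun b hb => ?_⟩, ?_, fun b hb => ?_⟩
  · rintro _ ⟨i, -, rfl⟩
    exact (dvd_garside hw₀).mp dvd_rfl i
  · exact (dvd_garside hw₀).mpr fun i => hb _ ⟨i, trivial, rfl⟩
  · rintro _ ⟨i, -, rfl⟩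
    exact (rightDvd_garside hw₀).mp ⟨1, (one_mul _).symm⟩ i
  · exact (rightDvd_garside hw₀).mpr fun i => hb _ ⟨i, trivial, rfl⟩

theorem mem_minimalElements_iff (hw₀ : ∀ w, cs.WeakLE w w₀) {m : ArtinMonoid Γ} :
    m ∈ minimalElements Γ ↔ m ∣ posLift cs w₀ := by
  constructor
  · rintro ⟨T, d, -, hd, hm⟩
    refine hm.trans (hd.1.2 _ ?_)
    rintro _ ⟨i, -, rfl⟩
    exact (dvd_garside hw₀).mp dvd_rfl i
  · intro hm
    refine ⟨Set.univ, _, ?_, isGarsideElement_posLift hw₀, hm⟩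
    have : Finite Γ.Group := Finite.of_equiv W cs.mulEquiv.toEquiv
    exact Finite.of_equiv _ (Γ.reindexGroupEquiv (Equiv.Set.univ B).symm).symm.toEquiv

theorem exists_garside_mul (hw₀ : ∀ w, cs.WeakLE w w₀) (x : ArtinMonoid Γ) :
    ∃ y, posLift cs w₀ * x = y * posLift cs w₀ := by
  obtain ⟨y, hy⟩ := exists_mul_garside hw₀ (reverse cs x)
  refine ⟨reverse cs y, ?_⟩
  rw [← reverse_reverse cs (posLift cs w₀ * x), reverse_mul, reverse_garside hw₀, hy, reverse_mul,
    reverse_garside hw₀]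

theorem exists_common_left_multiple (cs : CoxeterSystem Γ W) (x y : ArtinMonoid Γ) :
    ∃ p q, p * x = q * y := by
  obtain ⟨w₀, hw₀⟩ := cs.exists_longest
  induction y using gen_induction with
  | one => exact ⟨1, x, by simp⟩
  | mul i y ih =>
    obtain ⟨p, q, hpq⟩ := ih
    obtain ⟨r, hr⟩ := exists_garside_mul hw₀ q
    obtain ⟨c, hc⟩ := (rightDvd_garside hw₀).mp ⟨1, (one_mul _).symm⟩ i
    refine ⟨posLift cs w₀ * p, r * c, ?_⟩
    rw [mul_assoc, hpq, ← mul_assoc, hr, hc, mul_assoc, mul_assoc, mul_assoc]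

theorem exists_common_right_multiple (cs : CoxeterSystem Γ W) (x y : ArtinMonoid Γ) :
    ∃ z, x ∣ z ∧ y ∣ z := by
  obtain ⟨p, q, h⟩ := exists_common_left_multiple cs (reverse cs x) (reverse cs y)
  refine ⟨reverse cs (p * reverse cs x), ?_, ?_⟩
  · exact ⟨reverse cs p, by rw [reverse_mul, reverse_reverse]⟩
  · exact ⟨reverse cs q, by rw [h, reverse_mul, reverse_reverse]⟩

/-! ### The Artin monoid inside the Artin group -/

/-- The Artin monoid embeds into its localization at all elements, which is a group to which the
Artin group maps. -/
theorem toGroup_injective (cs : CoxeterSystem Γ W) : Function.Injective (toGroup Γ) := by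
  choose p q hpq using exists_common_left_multiple (Γ := Γ) cs
  let _ : OreLocalization.OreSet (⊤ : Submonoid (ArtinMonoid Γ)) :=
    { ore_right_cancel := fun x y s h => ⟨1, by rw [mul_right_cancel_artin cs _ h]⟩
      oreNum := fun r s => q r s
      oreDenom := fun r s => ⟨p r s, trivial⟩
      ore_eq := fun r s => hpq r s }
  let num : ArtinMonoid Γ →* OreLocalization (⊤ : Submonoid (ArtinMonoid Γ)) (ArtinMonoid Γ) :=
    OreLocalization.numeratorHom
  let f : B → (OreLocalization (⊤ : Submonoid (ArtinMonoid Γ)) (ArtinMonoid Γ))ˣ := fun i =>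
    OreLocalization.numeratorUnit ⟨gen Γ i, trivial⟩
  have hf : (Units.coeHom _).comp ((FreeGroup.lift f).comp (FreeMonoid.lift FreeGroup.of)) =
      num.comp (PresentedMonoid.mk (monoidRels Γ)) :=
    FreeMonoid.hom_eq fun i => by simp [f, num]; rfl
  have hrel : ∀ r ∈ groupRels Γ, FreeGroup.lift f r = 1 := by
    rintro _ ⟨u, v, huv, rfl⟩
    rw [map_mul, map_inv, mul_inv_eq_one]
    refine Units.ext ?_
    have hu := DFunLike.congr_fun hf u
    have hv := DFunLike.congr_fun hf v
    have huv' := PresentedMonoid.mk_eq_mk_of_rel huv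
    simp only [MonoidHom.comp_apply, Units.coeHom_apply] at hu hv
    rw [hu, hv, huv']
  have hnum : (Units.coeHom _).comp ((PresentedGroup.toGroup hrel).comp (toGroup Γ)) = num :=
    PresentedMonoid.ext _ fun i => by
      simp [toGroup, f, num]; rfl
  have hinj : Function.Injective num := by
    intro x y h
    obtain ⟨u, v, h1, h2⟩ := OreLocalization.oreDiv_eq_iff.mp h
    simp only [OneMemClass.coe_one, mul_one] at h2
    rw [← h2] at h1
    exact (mul_left_cancel_artin cs (u : ArtinMonoid Γ) h1).symm
  intro x y h
  apply hinj
  rw [← hnum]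
  simp only [MonoidHom.comp_apply, h]

variable (cs)

/-! ### The retraction of the group onto the monoid -/

theorem exists_toGroup_mul_eq (cs : CoxeterSystem Γ W) (x : ArtinGroup Γ) :
    ∃ p q, toGroup Γ p * x = toGroup Γ q := by
  have hx : x ∈ Subgroup.closure (Set.range PresentedGroup.of) := by
    rw [PresentedGroup.closure_range_of]; trivial
  induction hx using Subgroup.closure_induction_right with
  | one => exact ⟨1, 1, by simp⟩
  | mul_right x _ y hy ih =>
    obtain ⟨i, rfl⟩ := hy
    obtain ⟨p, q, h⟩ := ih
    exact ⟨p, q * gen Γ i, by rw [← mul_assoc, h, map_mul]; rfl⟩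
  | mul_inv_cancel x _ y hy ih =>
    obtain ⟨i, rfl⟩ := hy
    obtain ⟨p, q, h⟩ := ih
    obtain ⟨e, f, hef⟩ := exists_common_left_multiple cs q (gen Γ i)
    refine ⟨e * p, f, ?_⟩
    rw [map_mul, mul_assoc, ← mul_assoc _ x, h, ← mul_assoc, mul_inv_eq_iff_eq_mul, ← map_mul, hef,
      map_mul]
    rfl

/-- Every element of the Artin group has a join with `1` for the order in which `x` is below `y` if
`x⁻¹ * y` lies in the Artin monoid. -/
theorem exists_join_one (cs : CoxeterSystem Γ W) (x : ArtinGroup Γ) :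
    ∃ c, (∃ d, toGroup Γ c = x * toGroup Γ d) ∧ ∀ y e, toGroup Γ y = x * toGroup Γ e → c ∣ y := by
  obtain ⟨p, q, hpq⟩ := exists_toGroup_mul_eq cs x
  obtain ⟨m, hpm, hqm⟩ := exists_common_right_multiple cs p q
  obtain ⟨z, ⟨c, rfl⟩, ⟨d, hd⟩, hz⟩ := exists_lcm_artin cs hpm hqm
  refine ⟨c, ⟨d, ?_⟩, fun y e h => ?_⟩
  · have := congrArg (toGroup Γ) hd
    rw [map_mul, map_mul, ← hpq, mul_assoc] at this
    exact mul_left_cancel this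
  · have hy : q ∣ p * y := by
      refine ⟨e, toGroup_injective cs ?_⟩
      rw [map_mul, map_mul, ← hpq, h, mul_assoc]
    obtain ⟨k, hk⟩ := hz (p * y) ⟨y, rfl⟩ hy
    rw [mul_assoc] at hk
    exact ⟨k, mul_left_cancel_artin cs p hk⟩

/-- The join of an element of the Artin group with `1`, which is an element of the Artin monoid. -/
noncomputable def joinOne (x : ArtinGroup Γ) : ArtinMonoid Γ := (exists_join_one cs x).choose

theorem exists_toGroup_joinOne (x : ArtinGroup Γ) :
    ∃ d, toGroup Γ (joinOne cs x) = x * toGroup Γ d := (exists_join_one cs x).choose_spec.1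

theorem joinOne_dvd {x : ArtinGroup Γ} {y e : ArtinMonoid Γ}
    (h : toGroup Γ y = x * toGroup Γ e) : joinOne cs x ∣ y :=
  (exists_join_one cs x).choose_spec.2 y e h

theorem joinOne_toGroup (a : ArtinMonoid Γ) : joinOne cs (toGroup Γ a) = a := by
  refine dvd_antisymm_artin (joinOne_dvd cs (e := 1) (by simp)) ?_
  obtain ⟨d, hd⟩ := exists_toGroup_joinOne cs (toGroup Γ a)
  rw [← map_mul] at hd
  exact ⟨d, toGroup_injective cs hd⟩

/-- Taking the join with `1` preserves the relation `x ≤ y ≤ x * Δ`. -/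
theorem exists_joinOne_mul_eq (x : ArtinGroup Γ) {m : ArtinMonoid Γ} (hm : m ∈ minimalElements Γ) :
    ∃ m' ∈ minimalElements Γ, joinOne cs (x * toGroup Γ m) = joinOne cs x * m' := by
  obtain ⟨w₀, hw₀⟩ := cs.exists_longest
  simp only [mem_minimalElements_iff hw₀] at hm ⊢
  obtain ⟨k, hk⟩ := hm
  obtain ⟨d, hd⟩ := exists_toGroup_joinOne cs x
  obtain ⟨d', hd'⟩ := exists_toGroup_joinOne cs (x * toGroup Γ m)
  obtain ⟨m', hm'⟩ : joinOne cs x ∣ joinOne cs (x * toGroup Γ m) :=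
    joinOne_dvd cs (e := m * d') (by rw [hd', map_mul, mul_assoc])
  refine ⟨m', ?_, hm'⟩
  obtain ⟨e, he⟩ := exists_mul_garside hw₀ d
  obtain ⟨k', hk'⟩ : joinOne cs (x * toGroup Γ m) ∣ joinOne cs x * posLift cs w₀ := by
    refine joinOne_dvd cs (e := k * e) ?_
    rw [map_mul, hd, mul_assoc, ← map_mul, he, hk, mul_assoc m, map_mul, mul_assoc]
  rw [hm', mul_assoc] at hk'
  exact ⟨k', mul_left_cancel_artin cs _ hk'⟩

/-- The map `joinOne`, with values among the vertices of the monoid Cayley graph. -/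
noncomputable def retraction (x : ArtinGroup Γ) : positiveElements Γ :=
  ⟨toGroup Γ (joinOne cs x), joinOne cs x, rfl⟩

theorem retraction_coe (a : positiveElements Γ) : retraction cs (a : ArtinGroup Γ) = a := by
  obtain ⟨_, a, rfl⟩ := a
  exact Subtype.ext (congrArg (toGroup Γ) (joinOne_toGroup cs a))

theorem eq_or_adj_of_mul_mem {x y : positiveElements Γ} {m : ArtinMonoid Γ}
    (hm : m ∈ minimalElements Γ) (h : (y : ArtinGroup Γ) = x * toGroup Γ m) :
    x = y ∨ (monoidCayleyGraph Γ).Adj x y := by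
  refine or_iff_not_imp_left.mpr fun hne => ?_
  rw [monoidCayleyGraph, SimpleGraph.comap_adj, cayleyGraph, SimpleGraph.mulCayley_adj]
  exact ⟨fun h => hne (Subtype.ext h), Or.inl ⟨m, hm, by simp [h]⟩⟩

theorem retraction_adj {x y : ArtinGroup Γ} (h : (cayleyGraph Γ).Adj x y) :
    retraction cs x = retraction cs y ∨
      (monoidCayleyGraph Γ).Adj (retraction cs x) (retraction cs y) := by
  have key : ∀ {x y : ArtinGroup Γ}, x⁻¹ * y ∈ toGroup Γ '' minimalElements Γ →
      retraction cs x = retraction cs y ∨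
        (monoidCayleyGraph Γ).Adj (retraction cs x) (retraction cs y) := by
    rintro x y ⟨m, hm, hxy⟩
    obtain rfl : y = x * toGroup Γ m := by rw [hxy, mul_inv_cancel_left]
    obtain ⟨m', hm', h⟩ := exists_joinOne_mul_eq cs x hm
    exact eq_or_adj_of_mul_mem hm' (by simp only [retraction, h, map_mul])
  rw [cayleyGraph, SimpleGraph.mulCayley_adj] at h
  rcases h.2 with h | h
  · exact key h
  · exact (key h).imp Eq.symm SimpleGraph.Adj.symm

theorem monoidCayleyGraph_preconnected (cs : CoxeterSystem Γ W) :
    (monoidCayleyGraph Γ).Preconnected := by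
  obtain ⟨w₀, hw₀⟩ := cs.exists_longest
  have key : ∀ x a : ArtinMonoid Γ, (monoidCayleyGraph Γ).Reachable
      ⟨toGroup Γ a, a, rfl⟩ ⟨toGroup Γ (a * x), a * x, rfl⟩ := by
    intro x
    induction x using gen_induction with
    | one => intro a; simp
    | mul i x ih =>
      intro a
      have h := ih (a * gen Γ i)
      simp only [mul_assoc] at h
      refine SimpleGraph.Reachable.trans ?_ h
      have hi : gen Γ i ∈ minimalElements Γ :=
        (mem_minimalElements_iff hw₀).mpr ((dvd_garside hw₀).mp dvd_rfl i)
      rcases eq_or_adj_of_mul_mem (x := ⟨toGroup Γ a, a, rfl⟩)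
        (y := ⟨toGroup Γ (a * gen Γ i), _, rfl⟩) hi (map_mul _ _ _) with h' | h'
      · rw [h']
      · exact h'.reachable
  have hone : ∀ a : positiveElements Γ, (monoidCayleyGraph Γ).Reachable ⟨1, 1, map_one _⟩ a := by
    rintro ⟨_, a, rfl⟩
    simpa using key a 1
  exact fun a b => (hone a).symm.trans (hone b)

/-- A map that sends adjacent vertices to equal or adjacent ones does not increase distances. -/
theorem edist_map_le {V V' : Type*} {G : SimpleGraph V} {G' : SimpleGraph V'} (f : V → V')
    (hf : ∀ {x y}, G.Adj x y → f x = f y ∨ G'.Adj (f x) (f y)) (a b : V) :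
    G'.edist (f a) (f b) ≤ G.edist a b := by
  have key : ∀ {a b} (p : G.Walk a b), G'.edist (f a) (f b) ≤ p.length := by
    intro a b p
    induction p with
    | nil => simp
    | @cons _ b _ h p ih =>
      refine (G'.edist_triangle (v := f b)).trans ?_
      rw [SimpleGraph.Walk.length_cons, Nat.cast_add, Nat.cast_one, add_comm]
      refine add_le_add ih ?_
      rw [SimpleGraph.edist_le_one_iff_adj_or_eq]
      exact (hf h).symm
  by_cases hr : G.Reachable a b
  · obtain ⟨p, hp⟩ := hr.exists_walk_length_eq_edist
    exact hp ▸ key p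
  · rw [SimpleGraph.edist_eq_top_of_not_reachable hr]
    exact le_top

theorem edist_monoidCayleyGraph (cs : CoxeterSystem Γ W) (a b : positiveElements Γ) :
    (monoidCayleyGraph Γ).edist a b =
      (cayleyGraph Γ).edist (a : ArtinGroup Γ) (b : ArtinGroup Γ) := by
  refine le_antisymm ?_ (edist_map_le Subtype.val (fun h => Or.inr h) a b)
  have := edist_map_le (retraction cs) (retraction_adj cs) (a : ArtinGroup Γ) b
  rwa [retraction_coe, retraction_coe] at this

end Artin

/-- For an Artin group of finite type, the path metric of the monoid Cayley graph is the restriction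
of the path metric of the Cayley graph with respect to the minimal elements; and any two elements of
the monoid are joined by a geodesic of the Cayley graph all of whose vertices lie in the monoid. -/
theorem proposition6p1 {S : Type*} [Finite S] (Γ : CoxeterMatrix S)
    (hΓ : Artin.IsFiniteType Γ) :
    (∀ a b : Artin.positiveElements Γ,
      (Artin.monoidCayleyGraph Γ).edist a b =
        (Artin.cayleyGraph Γ).edist (a : Artin.ArtinGroup Γ) (b : Artin.ArtinGroup Γ)) ∧
    (∀ a b : Artin.ArtinGroup Γ, a ∈ Artin.positiveElements Γ → b ∈ Artin.positiveElements Γ →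
      ∃ p : (Artin.cayleyGraph Γ).Walk a b,
        (p.length : ℕ∞) = (Artin.cayleyGraph Γ).edist a b ∧
        ∀ v ∈ p.support, v ∈ Artin.positiveElements Γ) := by
  have : Finite Γ.Group := hΓ
  have hdist := Artin.edist_monoidCayleyGraph Γ.toCoxeterSystem
  refine ⟨hdist, fun a b ha hb => ?_⟩
  obtain ⟨p, hp⟩ := (Artin.monoidCayleyGraph_preconnected Γ.toCoxeterSystem ⟨a, ha⟩
    ⟨b, hb⟩).exists_walk_length_eq_edist
  let incl : Artin.monoidCayleyGraph Γ →g Artin.cayleyGraph Γ := ⟨Subtype.val, fun h => h⟩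
  refine ⟨p.map incl, ?_, fun v hv => ?_⟩
  · rw [SimpleGraph.Walk.length_map, hp, hdist]
  · rw [SimpleGraph.Walk.support_map] at hv
    obtain ⟨x, -, rfl⟩ := List.mem_map.mp hv
    exact x.2
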